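/- Let $A:S^3\to S^3$, $A(x)=-x$, be the antipodal map of the unit sphere $S^3\subset\mathbb R^4$, let $\mathbb{RP}^3=S^3/A$, and let $p:S^3\to\mathbb{RP}^3$ be the quotient map. Let $Z$ be a smooth vector field on $\mathbb{RP}^3$ and let $\widehat Z$ be its lift to $S^3$, i.e. the vector field with $dp\circ\widehat Z=Z\circ p$. A prime periodic orbit of a vector field is a trajectory $\gamma:\mathbb R\to M$ which, for some $T>0$, descends to an injective map $\mathbb R/T\mathbb Z\to M$; it is considered up to time translation, and it is called contractible if the loop $\mathbb R/T\mathbb Z\to M$ is null-homotopic. Then assigning to an orbit $z$ of $Z$ the set of prime periodic orbits $\widehat z$ of $\widehat Z$ with $p\circ\widehat z=z$ (up to time translation) defines a bijection from the set of contractible prime periodic orbits of $Z$ onto the set of unordered pairs $\{\widehat z,A(\widehat z)\}$ of prime periodic orbits of $\widehat Z$ such that $\widehat z$ and $A(\widehat z)$ are disjoint. The inverse bijection assigns to such a pair the common projection $p(\widehat z)=p(A(\widehat z))$. Furthermore, for every such pair the linking number $\operatorname{lk}(\widehat z,A(\widehat z))\in\mathbb Z$ of the two knots in $S^3$ is even.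 -/

import Mathlib

open Set Metric
open scoped Manifold ContDiff

noncomputable section

/-! ### The three-sphere, the antipodal map and real projective three-space -/

/-- Euclidean four-space. -/
abbrev E4 : Type := EuclideanSpace ℝ (Fin 4)

/-- The unit sphere `S³` in `ℝ⁴`, with Mathlib's smooth structure. The antipodal map is `x ↦ -x`. -/
abbrev S3 : Type := sphere (0 : E4) 1

/-- Two points of `S³` are identified when they are equal or antipodal. -/
def antipodalSetoid : Setoid S3 where
  r x y := x = y ∨ x = -y
  iseqv :=
    { refl := fun _ => Or.inl rfl
      symm := by
        rintro x y (h | h)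
        · exact Or.inl h.symm
        · exact Or.inr (by rw [h, neg_neg])
      trans := by
        rintro x y z (rfl | rfl) (rfl | rfl)
        · exact Or.inl rfl
        · exact Or.inr rfl
        · exact Or.inr rfl
        · exact Or.inl (neg_neg _) }

/-- Real projective three-space, the quotient of `S³` by the antipodal map. -/
def RP3 : Type := Quotient antipodalSetoid

/-- The quotient topology on `ℝP³`. -/
instance : TopologicalSpace RP3 := inferInstanceAs (TopologicalSpace (Quotient antipodalSetoid))

/-- The quotient map `S³ → ℝP³`. -/
def projRP3 (x : S3) : RP3 := Quotient.mk antipodalSetoid x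

theorem projRP3_eq_iff {x y : S3} : projRP3 x = projRP3 y ↔ x = y ∨ x = -y :=
  Quotient.eq (r := antipodalSetoid)

theorem projRP3_surjective : Function.Surjective projRP3 := Quotient.mk_surjective

theorem continuous_projRP3 : Continuous projRP3 := continuous_quotient_mk'

theorem isOpenMap_projRP3 : IsOpenMap projRP3 := by
  intro U hU
  have h : IsOpen (projRP3 ⁻¹' (projRP3 '' U)) := by
    have : projRP3 ⁻¹' (projRP3 '' U) = U ∪ (fun x : S3 => -x) ⁻¹' U := by
      ext x
      simp only [mem_preimage, mem_image, mem_union, projRP3_eq_iff]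
      constructor
      · rintro ⟨y, hy, rfl | rfl⟩
        · exact Or.inl hy
        · exact Or.inr hy
      · rintro (hx | hx)
        · exact ⟨x, hx, Or.inl rfl⟩
        · exact ⟨-x, hx, Or.inr rfl⟩
    rw [this]
    exact hU.union (hU.preimage continuous_neg)
  exact h

theorem S3_dist_neg (x : S3) : dist x (-x) = 2 := by
  have hx : ‖(x : E4)‖ = 1 := by simp
  rw [Subtype.dist_eq, dist_eq_norm]
  have : (x : E4) - ((-x : S3) : E4) = (2 : ℝ) • (x : E4) := by
    rw [two_smul]; simp
  rw [this, norm_smul, hx]; norm_num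

theorem isLocalHomeomorph_projRP3 : IsLocalHomeomorph projRP3 := by
  rw [isLocalHomeomorph_iff_isOpenEmbedding_restrict]
  intro x
  refine ⟨ball x 1, isOpen_ball.mem_nhds (mem_ball_self one_pos), ?_⟩
  refine Topology.IsOpenEmbedding.of_continuous_injective_isOpenMap
    (continuous_projRP3.comp continuous_subtype_val) ?_
    (isOpenMap_projRP3.comp isOpen_ball.isOpenMap_subtype_val)
  rintro ⟨y, hy⟩ ⟨z, hz⟩ h
  rcases projRP3_eq_iff.1 h with h | h
  · exact Subtype.ext h
  · exfalso
    rw [mem_ball] at hy hz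
    have h1 := S3_dist_neg z
    have h2 := dist_triangle z x (-z)
    rw [← h, dist_comm x y] at h2
    rw [← h] at h1
    linarith

/-- The charts of `ℝP³` are the charts of `S³` composed with local inverses of the projection. -/
instance : ChartedSpace (EuclideanSpace ℝ (Fin 3)) RP3 :=
  isLocalHomeomorph_projRP3.chartedSpace projRP3_surjective

theorem contMDiffAt_localInverse_comp_projRP3 (x z : S3)
    (hz : projRP3 z ∈ (isLocalHomeomorph_projRP3.localInverseAt x).source) :
    ContMDiffAt (𝓡 3) (𝓡 3) ω
      (fun w => isLocalHomeomorph_projRP3.localInverseAt x (projRP3 w)) z := by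
  set h := isLocalHomeomorph_projRP3.localInverseAt x with hh
  have hp : ∀ y ∈ h.source, projRP3 (h y) = y := fun y hy =>
    isLocalHomeomorph_projRP3.apply_localInverseAt_of_mem hy
  have hc : ContinuousAt (fun w => h (projRP3 w)) z :=
    ContinuousAt.comp (f := projRP3) (h.continuousAt hz) continuous_projRP3.continuousAt
  have hs : ∀ᶠ w in nhds z, projRP3 w ∈ h.source :=
    continuous_projRP3.continuousAt.eventually (h.open_source.mem_nhds hz)
  have key : ∀ σ : S3 → S3, ContMDiff (𝓡 3) (𝓡 3) ω σ → h (projRP3 z) = σ z →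
      (∀ w u : S3, u = w ∨ u = -w → u ≠ σ w → u = -σ w) →
      ContMDiffAt (𝓡 3) (𝓡 3) ω (fun w => h (projRP3 w)) z := by
    intro σ hσ hσz hσ2
    refine hσ.contMDiffAt.congr_of_eventuallyEq ?_
    have hd : ContinuousAt (fun w => dist (h (projRP3 w)) (σ w)) z :=
      hc.dist hσ.continuous.continuousAt
    have hd' : ∀ᶠ w in nhds z, dist (h (projRP3 w)) (σ w) < 1 :=
      hd.eventually (gt_mem_nhds (by simp only [hσz, dist_self]; exact one_pos))
    filter_upwards [hs, hd'] with w hw1 hw2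
    by_contra hne
    have := hσ2 w _ (projRP3_eq_iff.1 (hp _ hw1)) hne
    rw [this, dist_comm, S3_dist_neg] at hw2
    linarith
  rcases projRP3_eq_iff.1 (hp _ hz) with h1 | h1
  · exact key id contMDiff_id h1 (fun w u hu hn => hu.resolve_left hn)
  · have : Fact (Module.finrank ℝ E4 = 3 + 1) := ⟨by simp⟩
    refine key (fun w => -w) contMDiff_neg_sphere h1 (fun w u hu hn => ?_)
    rw [neg_neg]; exact hu.resolve_right hn

/-- `ℝP³` is an (analytic, in particular smooth) manifold. -/
instance : IsManifold (𝓡 3) ω RP3 := by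
  apply isManifold_of_contDiffOn
  rintro e e' ⟨q, rfl⟩ ⟨q', rfl⟩
  generalize projRP3_surjective.hasRightInverse.choose q = x
  generalize projRP3_surjective.hasRightInverse.choose q' = x'
  rw [← contMDiffOn_iff_contDiffOn]
  intro u hu
  simp only [modelWithCornersSelf_coe, modelWithCornersSelf_coe_symm, preimage_id, range_id,
    inter_univ, OpenPartialHomeomorph.trans_source, OpenPartialHomeomorph.symm_source,
    OpenPartialHomeomorph.trans_target, mem_inter_iff, mem_preimage,
    OpenPartialHomeomorph.coe_trans_symm, Function.comp_apply,
    IsLocalHomeomorph.localInverseAt_symm] at hu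
  obtain ⟨⟨hu1, -⟩, hu2, hu3⟩ := hu
  have h1 : ContMDiffAt (𝓡 3) (𝓡 3) ω (chartAt (EuclideanSpace ℝ (Fin 3)) x).symm u :=
    (contMDiffOn_chart_symm (I := 𝓡 3)).contMDiffAt
      ((chartAt (EuclideanSpace ℝ (Fin 3)) x).open_target.mem_nhds hu1)
  have h2 := contMDiffAt_localInverse_comp_projRP3 x' _ hu2
  have h3 := (contMDiffOn_chart (I := 𝓡 3) (n := ω) (x := x')).contMDiffAt
    ((chartAt (EuclideanSpace ℝ (Fin 3)) x').open_source.mem_nhds hu3)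
  have h4 : ContMDiffAt (𝓡 3) (𝓡 3) ω
      (fun w => chartAt (EuclideanSpace ℝ (Fin 3)) x'
        (isLocalHomeomorph_projRP3.localInverseAt x' (projRP3 w)))
      ((chartAt (EuclideanSpace ℝ (Fin 3)) x).symm u) :=
    ContMDiffAt.comp (g := chartAt (EuclideanSpace ℝ (Fin 3)) x')
      (f := fun w => isLocalHomeomorph_projRP3.localInverseAt x' (projRP3 w)) _ h3 h2
  have h5 := ContMDiffAt.comp (f := (chartAt (EuclideanSpace ℝ (Fin 3)) x).symm) u h4 h1
  refine (h5.congr_of_eventuallyEq (Filter.Eventually.of_forall fun w => ?_)).contMDiffWithinAt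
  simp

/-! ### Periodic orbits of vector fields -/

section PeriodicOrbits

variable {M : Type*} [TopologicalSpace M] [ChartedSpace (EuclideanSpace ℝ (Fin 3)) M]
  [IsManifold (𝓡 3) ∞ M]

/-- `Z` is a smooth vector field on the three-manifold `M`. -/
def IsSmoothVectorField (Z : (x : M) → TangentSpace (𝓡 3) x) : Prop :=
  ContMDiff (𝓡 3) (𝓡 3).tangent ∞ (fun x => (⟨x, Z x⟩ : TangentBundle (𝓡 3) M))

/-- `γ` is a periodic trajectory of `Z` with period `T > 0` that is prime, i.e. it descends to an
injective map `ℝ / Tℤ → M`. In particular `T` is the minimal period and `γ` is not constant. -/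
structure IsPrimePeriodic (Z : (x : M) → TangentSpace (𝓡 3) x) (γ : ℝ → M) (T : ℝ) : Prop where
  period_pos : 0 < T
  isMIntegralCurve : IsMIntegralCurve γ Z
  eq_iff : ∀ s t : ℝ, γ s = γ t ↔ ∃ n : ℤ, s = t + n * T

/-- The orbit of a trajectory `γ`: its class modulo time translation. -/
def orbitOf {X : Type*} (γ : ℝ → X) : Set (ℝ → X) :=
  {η | ∃ a : ℝ, ∀ t : ℝ, η t = γ (t + a)}

/-- The set of prime periodic orbits of `Z`, as trajectories modulo time translation. -/
def primeOrbits (Z : (x : M) → TangentSpace (𝓡 3) x) : Set (Set (ℝ → M)) :=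
  {O | ∃ γ T, IsPrimePeriodic Z γ T ∧ O = orbitOf γ}

/-- The loop `ℝ / Tℤ → X` induced by the `T`-periodic curve `γ` is continuous and null-homotopic. -/
def IsContractibleLoop {X : Type*} [TopologicalSpace X] (γ : ℝ → X) (T : ℝ) : Prop :=
  ∃ f : C(AddCircle T, X), (∀ t : ℝ, f (t : AddCircle T) = γ t) ∧ f.Nullhomotopic

/-- The set of contractible prime periodic orbits of `Z`. -/
def contractiblePrimeOrbits (Z : (x : M) → TangentSpace (𝓡 3) x) : Set (Set (ℝ → M)) :=
  {O | ∃ γ T, IsPrimePeriodic Z γ T ∧ IsContractibleLoop γ T ∧ O = orbitOf γ}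

end PeriodicOrbits

/-! ### Lifting to the double cover -/

/-- The lift to `S³` of a vector field `Z` on `ℝP³`: the vector field `x ↦ (d_x p)⁻¹ (Z (p x))`,
where `p` is the quotient map. -/
def liftVF (Z : (x : RP3) → TangentSpace (𝓡 3) x) : (x : S3) → TangentSpace (𝓡 3) x :=
  VectorField.mpullback (𝓡 3) (𝓡 3) projRP3 Z

/-- The image of an orbit in `S³` under the antipodal map. -/
def antipodalOrbit (O : Set (ℝ → S3)) : Set (ℝ → S3) := (fun γ t => -γ t) '' O

/-- The projection to `ℝP³` of an orbit in `S³`. -/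
def projOrbit (O : Set (ℝ → S3)) : Set (ℝ → RP3) := (fun γ t => projRP3 (γ t)) '' O

/-- The support of an orbit: the set of points that it passes through. -/
def orbitSupport {X : Type*} (O : Set (ℝ → X)) : Set X := {x | ∃ γ ∈ O, ∃ t, γ t = x}

/-- The pairs `{O, A(O)}` of prime periodic orbits of the vector field `W` on `S³` that are exchanged
by the antipodal map `A` and are disjoint. -/
def antipodalPairs (W : (x : S3) → TangentSpace (𝓡 3) x) : Set (Set (Set (ℝ → S3))) :=
  {P | ∃ O, O ∈ primeOrbits W ∧ antipodalOrbit O ∈ primeOrbits W ∧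
    Disjoint (orbitSupport O) (orbitSupport (antipodalOrbit O)) ∧ P = {O, antipodalOrbit O}}

/-- The lifts of an orbit `z` of `Z`: the prime periodic orbits of the lifted vector field that
project to `z`. -/
def liftsOfOrbit (Z : (x : RP3) → TangentSpace (𝓡 3) x) (z : Set (ℝ → RP3)) :
    Set (Set (ℝ → S3)) :=
  {O | O ∈ primeOrbits (liftVF Z) ∧ projOrbit O = z}

/-- The common projection to `ℝP³` of the orbits in `P`. -/
def projOfPair (P : Set (Set (ℝ → S3))) : Set (ℝ → RP3) := projOrbit (⋃₀ P)

/-! ### Linking numbers -/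

/-- The determinant of four vectors of `ℝ⁴`. -/
def det4 (a b c d : E4) : ℝ := Matrix.det (Matrix.of fun i j => (![a, b, c, d] i : E4) j)

/-- Stereographic projection of the curve `γ` from the pole `v`, a curve in the hyperplane `v^⊥`. -/
def stereoCurve (v : S3) (γ : ℝ → S3) (t : ℝ) : E4 :=
  (stereoToFun (v : E4) (γ t : E4) : E4)

/-- The Gauss linking integral
`1/(4π) ∫∫ det(c₁ - c₂, c₁', c₂') / |c₁ - c₂|³`
of the stereographic projections `c₁`, `c₂` from the pole `v` of two closed curves in `S³` of periods
`T₁`, `T₂`. Here `S³` is oriented as the boundary of the unit ball, so that stereographic projection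
preserves the orientation when `v^⊥` is oriented by the volume form `det(-v, ·, ·, ·)`. -/
def gaussLinkingIntegral (v : S3) (γ₁ : ℝ → S3) (T₁ : ℝ) (γ₂ : ℝ → S3) (T₂ : ℝ) : ℝ :=
  1 / (4 * Real.pi) * ∫ s in (0 : ℝ)..T₁, ∫ t in (0 : ℝ)..T₂,
    det4 (-(v : E4)) (stereoCurve v γ₁ s - stereoCurve v γ₂ t)
        (deriv (stereoCurve v γ₁) s) (deriv (stereoCurve v γ₂) t) /
      ‖stereoCurve v γ₁ s - stereoCurve v γ₂ t‖ ^ 3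

/-- The integer `ℓ` is the linking number of the disjoint knots in `S³` parametrised by `γ₁`
(period `T₁`) and `γ₂` (period `T₂`): it is the value of Gauss's linking integral after stereographic
projection from a pole off both knots. Such poles exist, and all of them give the same value. -/
def HasLinkingNumber (γ₁ : ℝ → S3) (T₁ : ℝ) (γ₂ : ℝ → S3) (T₂ : ℝ) (ℓ : ℤ) : Prop :=
  (∃ v : S3, v ∉ range γ₁ ∪ range γ₂) ∧
    ∀ v : S3, v ∉ range γ₁ ∪ range γ₂ → gaussLinkingIntegral v γ₁ T₁ γ₂ T₂ = ℓ

end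

noncomputable section

/-! ### Gaussian volumes of cones in four-space -/

/-! The bijection is covering space theory. The projection `projRP3` is a two-sheeted covering and a
local diffeomorphism, so integral curves of `Z` and of `liftVF Z` correspond, and two lifts of one
curve agree up to sign and time translation. A null-homotopy of a loop lifts, so a contractible
prime orbit lifts to a curve closing up with the same period. If this lift met its antipode, the two
times would project to the same point, hence differ by a period, and some point would be its own
antipode. Conversely, a `C¹` loop in the three-sphere misses a point, so it and its projection are
null-homotopic; disjointness from the antipode keeps the projection prime.

For the linking number, `lk(x, -x)` is the degree of the join map `(s, t, r) ↦ (1 - r) x(s) + r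
x(t)`, which avoids the origin because the curve contains no antipodal points. Exchanging the two
factors of the join preserves orientation, so the degree is twice the contribution of one half.

This is made precise by measuring cones with a Gaussian of total mass one. The signed volumes of the
faces of a simplex avoiding the origin add up to an integer
(`sum_cramerCoeff_mul_coneGauss_mem_int`), so `coneVol` is modulo integers the coboundary of the
cones with a generic apex `u`. For a closed polygon joined with itself, the sum over pairs `i < j`
telescopes to an integer, and symmetry makes the full sum twice it
(`exists_even_sum_coneVol_polygon`). Refining the polygon gives an even `joinIntegral`
(`JoinIndep.exists_joinIntegral_self_eq`).

It remains to identify `joinIntegral` with Gauss's integral (`gauss_integral_antipodal_eq`). Being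
integral, it is invariant under homotopies avoiding the origin; these lead from `x`, `x` to `c - h
v`, `h v - d`, where `c`, `d` are the stereographic images of `x`, `-x`. As `h → ∞` the kernel
converges to Gauss's kernel. -/

/-- The determinant of the matrix with rows `x i`. -/
def rowDet (x : Fin 4 → E4) : ℝ := Matrix.det (Matrix.of fun i j => x i j)

/-- The integral over the positive orthant of a Gaussian precomposed with `t ↦ ∑ tᵢ xᵢ`. -/
def coneGauss (x : Fin 4 → E4) : ℝ :=
  ∫ t in Ici (0 : Fin 4 → ℝ), Real.exp (-(Real.pi * ‖∑ i, t i • x i‖ ^ 2))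

/-- The signed Gaussian volume of the cone spanned by four vectors. -/
def coneVol (x : Fin 4 → E4) : ℝ := rowDet x * coneGauss x

/-- The cone spanned by a family of vectors, in coordinates. -/
def coneSet (x : Fin 4 → E4) : Set (Fin 4 → ℝ) :=
  {w | ∃ t : Fin 4 → ℝ, 0 ≤ t ∧ ∀ j, ∑ i, t i * x i j = w j}

/-- The standard Gaussian density in coordinates. -/
def gaussDens (w : Fin 4 → ℝ) : ℝ := Real.exp (-(Real.pi * ∑ j, w j ^ 2))

/-- The parameters `τ` for which `m + τ l` lies in the positive orthant form an interval, bounded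
below as soon as some `l i` is positive. Each counted index is a coordinate with positive slope that
vanishes at the lower endpoint; distinctness of the ratios leaves exactly one if the interval is
nonempty. -/
theorem sum_count_pos {ι : Type*} [Fintype ι] (l m : ι → ℝ)
    (hne : ∀ i j, l i ≠ 0 → l j ≠ 0 → i ≠ j → m i / l i ≠ m j / l j) (hpos : ∃ i, 0 < l i) :
    open Classical in
    (∑ i, if 0 < l i ∧ ∀ j, 0 ≤ m j - m i / l i * l j then (1 : ℝ) else 0) =
      if ∃ τ : ℝ, ∀ j, 0 ≤ m j + τ * l j then 1 else 0 := by
  classical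
  obtain ⟨i₀, hi₀, hmin⟩ := Finset.exists_min_image (Finset.univ.filter fun i => 0 < l i)
    (fun i => m i / l i) (by obtain ⟨i, hi⟩ := hpos; exact ⟨i, by simpa using hi⟩)
  simp only [Finset.mem_filter, Finset.mem_univ, true_and] at hi₀ hmin
  have h1 : ∀ i, 0 < l i → (∀ j, 0 ≤ m j - m i / l i * l j) → i = i₀ := by
    intro i hi h
    by_contra hne'
    have h2 := h i₀
    have h3 : m i / l i ≤ m i₀ / l i₀ := by
      rw [le_div_iff₀ hi₀]; linarith
    exact hne i i₀ hi.ne' hi₀.ne' hne' (le_antisymm h3 (hmin i hi))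
  rw [Finset.sum_eq_single i₀]
  · congr 1
    apply propext
    constructor
    · rintro ⟨-, h⟩
      exact ⟨-(m i₀ / l i₀), fun j => by have := h j; linarith⟩
    · rintro ⟨τ, hτ⟩
      refine ⟨hi₀, fun j => ?_⟩
      have hτ0 : -τ ≤ m i₀ / l i₀ := by
        rw [le_div_iff₀ hi₀]; linarith [hτ i₀]
      rcases lt_trichotomy (l j) 0 with hj | hj | hj
      · nlinarith [hτ j]
      · have := hτ j; rw [hj] at this ⊢; linarith
      · have := hmin j hj
        rw [le_div_iff₀ hj] at this
        linarith
  · intro i _ hi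
    rw [if_neg]
    rintro ⟨h, h'⟩
    exact hi (h1 i h h')
  · simp

theorem integral_gaussDens : ∫ w, gaussDens w = 1 := by
  have h : gaussDens = fun w : Fin 4 → ℝ => ∏ j, Real.exp (-Real.pi * w j ^ 2) := by
    funext w
    rw [← Real.exp_sum, gaussDens, Finset.mul_sum, ← Finset.sum_neg_distrib]
    simp only [neg_mul]
  rw [h, MeasureTheory.integral_fintype_prod_volume_eq_pow
    (fun y : ℝ => Real.exp (-Real.pi * y ^ 2)), integral_gaussian, div_self Real.pi_ne_zero]
  simp

theorem integrable_gaussDens : MeasureTheory.Integrable gaussDens := by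
  by_contra h
  -- A non-integrable function has integral zero by convention, whereas this one has integral one.
  have := MeasureTheory.integral_undef h
  rw [integral_gaussDens] at this
  exact one_ne_zero this

theorem rowDet_eq_zero_of_relation (x : Fin 4 → E4) (t : Fin 4 → ℝ) (ht : t ≠ 0)
    (h : ∀ j, ∑ i, t i * x i j = 0) : rowDet x = 0 := by
  rw [rowDet]
  exact Matrix.exists_vecMul_eq_zero_iff.1 ⟨t, ht, funext fun j => h j⟩

/-- Linear change of variables: the orthant is carried injectively onto the cone with Jacobian
`|rowDet x|`. This is what makes `coneVol` a signed Gaussian measure. -/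
theorem measurableSet_coneSet_and_abs_rowDet_mul (x : Fin 4 → E4) (hx : rowDet x ≠ 0) :
    MeasurableSet (coneSet x) ∧
      |rowDet x| * coneGauss x = ∫ w, (coneSet x).indicator gaussDens w := by
  set M : Matrix (Fin 4) (Fin 4) ℝ := (Matrix.of fun i j => x i j).transpose with hM
  have hdet : M.det = rowDet x := by rw [hM, Matrix.det_transpose]; rfl
  have hd : M.det ≠ 0 := by rwa [hdet]
  set L : (Fin 4 → ℝ) → (Fin 4 → ℝ) := ⇑(Matrix.toLin' M) with hL
  have hLapp : ∀ t j, L t j = ∑ i, t i * x i j := by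
    intro t j
    simp [hL, hM, Matrix.mulVec, dotProduct, mul_comm]
  have hinj : Function.Injective L := by
    rw [hL]
    exact LinearMap.ker_eq_bot.1 (LinearMap.ker_eq_bot'.2 fun t ht => by
      by_contra h0
      exact hx (rowDet_eq_zero_of_relation x t h0 fun j => by rw [← hLapp, hL, ht]; rfl))
  have hcont : Continuous L := LinearMap.continuous_of_finiteDimensional _
  have hemb : MeasurableEmbedding L := hcont.measurableEmbedding hinj
  have himg : coneSet x = L '' Ici 0 := by
    ext w
    constructor
    · rintro ⟨t, ht, h⟩
      exact ⟨t, ht, funext fun j => by rw [hLapp, h]⟩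
    · rintro ⟨t, ht, rfl⟩
      exact ⟨t, ht, fun j => (hLapp t j).symm⟩
  have hmeas : MeasurableSet (coneSet x) := by
    rw [himg]; exact hemb.measurableSet_image.2 measurableSet_Ici
  refine ⟨hmeas, ?_⟩
  have h1 : coneGauss x = ∫ t, (coneSet x).indicator gaussDens (L t) := by
    rw [coneGauss, ← MeasureTheory.integral_indicator measurableSet_Ici]
    congr 1; funext t
    by_cases ht : t ∈ Ici (0 : Fin 4 → ℝ)
    · rw [indicator_of_mem ht, indicator_of_mem (by rw [himg]; exact ⟨t, ht, rfl⟩), gaussDens,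
        EuclideanSpace.norm_sq_eq]
      congr 4
      funext j
      rw [hLapp]; simp
    · rw [indicator_of_notMem ht, indicator_of_notMem]
      rw [himg]
      rintro ⟨s, hs, h⟩
      exact ht (hinj h ▸ hs)
  have h2 := Real.map_matrix_volume_pi_eq_smul_volume_pi hd
  rw [h1, ← hemb.integral_map, hL, h2, MeasureTheory.integral_smul_measure, hdet,
    ENNReal.toReal_ofReal (abs_nonneg _), smul_eq_mul, ← mul_assoc, abs_inv,
    mul_inv_cancel₀ (abs_ne_zero.2 hx), one_mul]

/-- The coefficients of the linear relation between five vectors of `ℝ⁴` given by Cramer's rule. -/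
def cramerCoeff (x : Fin 5 → E4) (i : Fin 5) : ℝ := (-1) ^ (i : ℕ) * rowDet (x ∘ i.succAbove)

/-- Expand along its first column a 5 × 5 determinant with a repeated column. -/
theorem sum_cramerCoeff (x : Fin 5 → E4) (j : Fin 4) : ∑ i, cramerCoeff x i * x i j = 0 := by
  have h : Matrix.det (Matrix.of fun (i : Fin 5) (k : Fin 5) =>
      (Fin.cons (x i j) (fun l : Fin 4 => x i l) : Fin 5 → ℝ) k) = 0 := by
    refine Matrix.det_zero_of_column_eq (i := 0) (j := j.succ) (Fin.succ_ne_zero j).symm ?_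
    intro k; simp
  rw [Matrix.det_succ_column_zero] at h
  rw [← h]
  refine Finset.sum_congr rfl fun i _ => ?_
  simp only [cramerCoeff, Matrix.of_apply, Fin.cons_zero]
  rw [mul_right_comm]
  rfl

theorem rowDet_ne_zero_of_cramerCoeff {x : Fin 5 → E4} {i : Fin 5} (h : cramerCoeff x i ≠ 0) :
    rowDet (x ∘ i.succAbove) ≠ 0 := fun h0 => h (by rw [cramerCoeff, h0, mul_zero])

/-- The coefficient vectors representing `w` include the line `m + τ l`, with `l` the Cramer
relation. The face omitting vector `i` contains `w` exactly when the point of this line with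
vanishing `i`-th coordinate is in the orthant. -/
theorem mem_coneSet_iff_of_cramerCoeff_ne_zero {x : Fin 5 → E4} {i : Fin 5}
    (hi : cramerCoeff x i ≠ 0) (m : Fin 5 → ℝ) (w : Fin 4 → ℝ)
    (hw : ∀ j, ∑ k, m k * x k j = w j) :
    w ∈ coneSet (x ∘ i.succAbove) ↔
      ∀ k, 0 ≤ m k - m i / cramerCoeff x i * cramerCoeff x k := by
  set a : Fin 5 → ℝ := fun k => m k - m i / cramerCoeff x i * cramerCoeff x k with ha
  have hai : a i = 0 := by simp only [ha]; field_simp; ring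
  have hsum : ∀ j, ∑ k : Fin 4, a (i.succAbove k) * x (i.succAbove k) j = w j := by
    intro j
    have h1 : ∑ k, a k * x k j = w j := by
      simp only [ha, sub_mul, Finset.sum_sub_distrib, hw]
      simp only [mul_assoc, ← Finset.mul_sum, sum_cramerCoeff]
      simp
    rw [Fin.sum_univ_succAbove _ i, hai, zero_mul, zero_add] at h1
    exact h1
  constructor
  · rintro ⟨t, ht, h⟩
    have heq : t = a ∘ i.succAbove := by
      by_contra hne
      refine rowDet_ne_zero_of_cramerCoeff hi
        (rowDet_eq_zero_of_relation _ (t - a ∘ i.succAbove) (sub_ne_zero.2 hne) fun j => ?_)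
      simp only [Pi.sub_apply, sub_mul, Finset.sum_sub_distrib]
      rw [h j]
      simp only [Function.comp_apply]
      rw [hsum j, sub_self]
    intro k
    rcases Fin.eq_self_or_eq_succAbove i k with rfl | ⟨l, rfl⟩
    · exact hai.ge
    · have := ht l
      rw [heq] at this
      exact this
  · intro h
    exact ⟨a ∘ i.succAbove, fun k => h _, fun j => hsum j⟩

/-- Three of the five vectors span a null set. Off these null sets the line of coefficient vectors
never has two coordinates vanishing at once, as needed for the counting lemmas. -/
theorem ae_notMem_span_pair_compl (x : Fin 5 → E4) :
    ∀ᵐ w : Fin 4 → ℝ, ∀ i j : Fin 5, i ≠ j → ∀ a : Fin 5 → ℝ, a i = 0 → a j = 0 →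
      ¬ ∀ k, ∑ l, a l * x l k = w k := by
  classical
  rw [MeasureTheory.ae_all_iff]; intro i
  rw [MeasureTheory.ae_all_iff]; intro j
  by_cases hij : i = j
  · exact Filter.Eventually.of_forall fun w h => absurd hij h
  set s : Finset (Fin 5) := (Finset.univ.erase i).erase j with hs
  have hcard : s.card = 3 := by
    rw [hs, Finset.card_erase_of_mem (by simp [Ne.symm hij]), Finset.card_erase_of_mem (by simp)]
    simp
  set v : Fin 5 → (Fin 4 → ℝ) := fun l k => x l k with hv
  set S : Submodule ℝ (Fin 4 → ℝ) := Submodule.span ℝ (s.image v : Set (Fin 4 → ℝ)) with hS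
  have hne : S ≠ ⊤ := by
    intro h
    have h1 : Module.finrank ℝ S ≤ (s.image v).card := finrank_span_finset_le_card _
    have h2 := Finset.card_image_le (s := s) (f := v)
    rw [h, finrank_top] at h1
    simp at h1
    omega
  have h0 := MeasureTheory.Measure.addHaar_submodule MeasureTheory.volume S hne
  filter_upwards [MeasureTheory.compl_mem_ae_iff.2 h0] with w hw _ a hai haj h
  apply hw
  have : w = ∑ l, a l • v l := by
    funext k; rw [← h k]; simp [hv]
  rw [this]
  refine Submodule.sum_mem _ fun l _ => ?_
  by_cases hl : l ∈ s
  · exact Submodule.smul_mem _ _ (Submodule.subset_span (by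
      rw [Finset.coe_image]; exact ⟨l, hl, rfl⟩))
  · have : a l = 0 := by
      simp only [hs, Finset.mem_erase, Finset.mem_univ, and_true, not_and_or, not_not] at hl
      rcases hl with rfl | rfl <;> assumption
    rw [this, zero_smul]; exact Submodule.zero_mem _

theorem cramerCoeff_mul_coneGauss (x : Fin 5 → E4) (i : Fin 5) :
    MeasureTheory.Integrable (fun w => SignType.sign (cramerCoeff x i) *
      (coneSet (x ∘ i.succAbove)).indicator gaussDens w) ∧
    cramerCoeff x i * coneGauss (x ∘ i.succAbove) =
      ∫ w, SignType.sign (cramerCoeff x i) * (coneSet (x ∘ i.succAbove)).indicator gaussDens w := by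
  by_cases h : cramerCoeff x i = 0
  · simp [h]
  obtain ⟨h1, h2⟩ := measurableSet_coneSet_and_abs_rowDet_mul _ (rowDet_ne_zero_of_cramerCoeff h)
  refine ⟨(integrable_gaussDens.indicator h1).const_mul _, ?_⟩
  rw [MeasureTheory.integral_const_mul, ← h2, ← mul_assoc]
  congr 1
  have : |cramerCoeff x i| = |rowDet (x ∘ i.succAbove)| := by
    rw [cramerCoeff, abs_mul, abs_pow, abs_neg, abs_one, one_pow, one_mul]
  rw [← this, sign_mul_abs]

/-- Positive slopes count the lower endpoint of the interval of admissible `τ`, negative slopes the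
upper one. If slopes of both signs occur, the two contributions cancel; otherwise only the lower
endpoint exists. -/
theorem sum_sign_count {l m : Fin 5 → ℝ}
    (hne : ∀ i j, l i ≠ 0 → l j ≠ 0 → i ≠ j → m i / l i ≠ m j / l j) (hpos : ∃ i, 0 < l i) :
    open Classical in
    (∑ i, if ∀ j, 0 ≤ m j - m i / l i * l j then ((SignType.sign (l i) : SignType) : ℝ) else 0) =
      if ∃ i, l i < 0 then 0 else if ∃ τ : ℝ, ∀ j, 0 ≤ m j + τ * l j then 1 else 0 := by
  classical
  have h1 := sum_count_pos l m hne hpos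
  have hsplit : ∀ i, (if ∀ j, 0 ≤ m j - m i / l i * l j then
      ((SignType.sign (l i) : SignType) : ℝ) else 0) =
      (if 0 < l i ∧ ∀ j, 0 ≤ m j - m i / l i * l j then (1 : ℝ) else 0) -
      (if 0 < -l i ∧ ∀ j, 0 ≤ m j - m i / (-l i) * (-l j) then (1 : ℝ) else 0) := by
    intro i
    have : ∀ j, m i / (-l i) * (-l j) = m i / l i * l j := by
      intro j; rw [div_neg]; ring
    simp only [this]
    rcases lt_trichotomy (l i) 0 with h | h | h
    · simp [h, h.le.not_gt, sign_neg h]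
      split_ifs <;> simp
    · simp [h]
    · simp [h, h.le.not_gt]
  simp only [hsplit, Finset.sum_sub_distrib]
  have h1' : (∑ i, if 0 < l i ∧ ∀ j, 0 ≤ m j - m i / l i * l j then (1 : ℝ) else 0) =
      if ∃ τ : ℝ, ∀ j, 0 ≤ m j + τ * l j then 1 else 0 := by convert h1
  rw [h1']
  by_cases hneg : ∃ i, l i < 0
  · rw [if_pos hneg]
    have h2 := sum_count_pos (fun i => -l i) m (fun i j hi hj hij => by
      rw [div_neg, div_neg, Ne, neg_inj]
      exact hne i j (neg_ne_zero.1 hi) (neg_ne_zero.1 hj) hij)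
      (by obtain ⟨i, hi⟩ := hneg; exact ⟨i, neg_pos.2 hi⟩)
    have h2' : (∑ i, if 0 < -l i ∧ ∀ j, 0 ≤ m j - m i / (-l i) * (-l j) then (1 : ℝ) else 0) =
      if ∃ τ : ℝ, ∀ j, 0 ≤ m j + τ * (-l j) then 1 else 0 := by convert h2
    rw [h2', sub_eq_zero]
    congr 1
    apply propext
    constructor
    · rintro ⟨τ, h⟩; exact ⟨-τ, fun j => by simpa using h j⟩
    · rintro ⟨τ, h⟩; exact ⟨-τ, fun j => by simpa using h j⟩
  · rw [if_neg hneg, Finset.sum_eq_zero (s := Finset.univ) (f := fun i =>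
      (if 0 < -l i ∧ ∀ j, 0 ≤ m j - m i / (-l i) * (-l j) then (1 : ℝ) else 0)), sub_zero]
    intro i _
    rw [if_neg]
    rintro ⟨h, -⟩
    exact hneg ⟨i, neg_pos.1 h⟩

/-- The Gaussian volumes of the faces of a simplex on five vectors add up to an integer, provided
that the origin is not on the boundary of the convex hull. -/
theorem sum_cramerCoeff_mul_coneGauss_mem_int (x : Fin 5 → E4)
    (hx : (∀ i, 0 ≤ cramerCoeff x i) → (∃ i, 0 < cramerCoeff x i) → ∀ i, 0 < cramerCoeff x i)
    (hx' : (∀ i, cramerCoeff x i ≤ 0) → (∃ i, cramerCoeff x i < 0) → ∀ i, cramerCoeff x i < 0) :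
    ∃ n : ℤ, ∑ i, cramerCoeff x i * coneGauss (x ∘ i.succAbove) = n := by
  classical
  set l := cramerCoeff x with hl
  by_cases h0 : ∀ i, l i = 0
  · exact ⟨0, by simp [h0]⟩
  push Not at h0
  obtain ⟨i₁, hi₁⟩ := h0
  -- The integer is the covering multiplicity of almost every `w` by the signed faces: `0`, `1` or
  -- `-1` according to the signs of the Cramer relation.
  suffices h : ∃ n : ℤ, ∀ᵐ w : Fin 4 → ℝ, ∑ i, (SignType.sign (l i) : ℝ) *
      (coneSet (x ∘ i.succAbove)).indicator gaussDens w = n * gaussDens w by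
    obtain ⟨n, hn⟩ := h
    refine ⟨n, ?_⟩
    rw [Finset.sum_congr rfl fun i _ => (cramerCoeff_mul_coneGauss x i).2,
      ← MeasureTheory.integral_finsetSum _ fun i _ => (cramerCoeff_mul_coneGauss x i).1,
      MeasureTheory.integral_congr_ae hn, MeasureTheory.integral_const_mul, integral_gaussDens,
      mul_one]
  have key : ∀ᵐ w : Fin 4 → ℝ, ∃ m : Fin 5 → ℝ,
      (∀ i j, l i ≠ 0 → l j ≠ 0 → i ≠ j → m i / l i ≠ m j / l j) ∧
      ∑ i, (SignType.sign (l i) : ℝ) * (coneSet (x ∘ i.succAbove)).indicator gaussDens w =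
      (∑ i, if ∀ j, 0 ≤ m j - m i / l i * l j then ((SignType.sign (l i) : SignType) : ℝ) else 0)
        * gaussDens w := by
    filter_upwards [ae_notMem_span_pair_compl x] with w hw
    obtain ⟨m, hm⟩ : ∃ m : Fin 5 → ℝ, ∀ j, ∑ k, m k * x k j = w j := by
      have hd := rowDet_ne_zero_of_cramerCoeff hi₁
      set M : Matrix (Fin 4) (Fin 4) ℝ := Matrix.of fun i j => (x ∘ i₁.succAbove) i j with hM
      -- Solve in the basis that omits `i₁`, with coefficient zero at `i₁`.
      refine ⟨i₁.insertNth 0 (Matrix.vecMul w M⁻¹), fun j => ?_⟩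
      rw [Fin.sum_univ_succAbove _ i₁]
      simp only [Fin.insertNth_apply_same, zero_mul, Fin.insertNth_apply_succAbove, zero_add]
      have : Matrix.vecMul (Matrix.vecMul w M⁻¹) M = w := by
        rw [Matrix.vecMul_vecMul, Matrix.nonsing_inv_mul _ (isUnit_iff_ne_zero.2 hd),
          Matrix.vecMul_one]
      exact congrFun this j
    refine ⟨m, fun i j hi hj hij h => ?_, ?_⟩
    · refine hw i j hij (fun k => m k - m i / l i * l k) (by field_simp; ring)
        (by rw [h]; field_simp; ring) fun k => ?_
      simp only [sub_mul, Finset.sum_sub_distrib, hm]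
      simp only [mul_assoc, ← Finset.mul_sum, hl, sum_cramerCoeff]
      simp
    · rw [Finset.sum_mul]
      refine Finset.sum_congr rfl fun i _ => ?_
      by_cases hi : l i = 0
      · simp [hi]
      have hiff := mem_coneSet_iff_of_cramerCoeff_ne_zero hi m w hm
      by_cases hw' : w ∈ coneSet (x ∘ i.succAbove)
      · rw [indicator_of_mem hw', if_pos (hiff.1 hw')]
      · rw [indicator_of_notMem hw', if_neg (fun h => hw' (hiff.2 h))]; simp
  by_cases hp : ∃ i, 0 < l i
  · by_cases hn : ∃ i, l i < 0
    · refine ⟨0, ?_⟩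
      filter_upwards [key] with w hw
      obtain ⟨m, h1, h2⟩ := hw
      rw [h2, sum_sign_count h1 hp, if_pos hn]; simp
    · have hall := hx (fun i => not_lt.1 fun h => hn ⟨i, h⟩) hp
      refine ⟨1, ?_⟩
      filter_upwards [key] with w hw
      obtain ⟨m, h1, h2⟩ := hw
      rw [h2, sum_sign_count h1 hp, if_neg hn, if_pos]
      · simp
      -- All slopes are positive, so every sufficiently large `τ` is admissible.
      obtain ⟨τ, hτ⟩ : ∃ τ : ℝ, ∀ j, -m j / l j ≤ τ :=
        ⟨∑ j, |-m j / l j|, fun j => (le_abs_self _).trans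
          (Finset.single_le_sum (f := fun j => |-m j / l j|) (fun _ _ => abs_nonneg _)
            (Finset.mem_univ j))⟩
      refine ⟨τ, fun j => ?_⟩
      have := hτ j
      rw [div_le_iff₀ (hall j)] at this
      linarith
  · have hn : ∃ i, l i < 0 := ⟨i₁, lt_of_le_of_ne (not_lt.1 fun h => hp ⟨i₁, h⟩) hi₁⟩
    have hall := hx' (fun i => not_lt.1 fun h => hp ⟨i, h⟩) hn
    refine ⟨-1, ?_⟩
    filter_upwards [key] with w hw
    obtain ⟨m, h1, h2⟩ := hw
    -- Reversing the line leaves the vanishing points unchanged and flips every sign.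
    have h3 := sum_sign_count (l := fun i => -l i) (m := m) (fun i j hi hj hij => by
      rw [div_neg, div_neg, Ne, neg_inj]
      exact h1 i j (neg_ne_zero.1 hi) (neg_ne_zero.1 hj) hij)
      (by obtain ⟨i, hi⟩ := hn; exact ⟨i, neg_pos.2 hi⟩)
    rw [if_neg (by rintro ⟨i, hi⟩; exact hp ⟨i, neg_neg_iff_pos.1 hi⟩), if_pos] at h3
    · rw [h2]
      have h4 : ∀ i j, m i / (-l i) * (-l j) = m i / l i * l j := by
        intro i j; rw [div_neg]; ring
      simp only [h4, Left.sign_neg] at h3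
      have h5 : (∑ i, if ∀ j, 0 ≤ m j - m i / l i * l j then
          ((SignType.sign (l i) : SignType) : ℝ) else 0) = -1 := by
        rw [← h3, ← Finset.sum_neg_distrib]
        refine Finset.sum_congr rfl fun i _ => ?_
        split_ifs <;> simp
      rw [h5]; simp
    · obtain ⟨τ, hτ⟩ : ∃ τ : ℝ, ∀ j, m j / l j ≤ τ :=
        ⟨∑ j, |m j / l j|, fun j => (le_abs_self _).trans
          (Finset.single_le_sum (f := fun j => |m j / l j|) (fun _ _ => abs_nonneg _)
            (Finset.mem_univ j))⟩
      refine ⟨τ, fun j => ?_⟩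
      have := hτ j
      rw [div_le_iff_of_neg (hall j)] at this
      linarith

/-! ### Symmetries of cone volumes and the coboundary formula modulo integers -/

/-- `rowDet` as an alternating map. -/
def rowDetAlternating : E4 [⋀^Fin 4]→ₗ[ℝ] ℝ :=
  (Matrix.detRowAlternating (n := Fin 4) (R := ℝ)).compLinearMap
    (WithLp.linearEquiv 2 ℝ (Fin 4 → ℝ)).toLinearMap

theorem rowDetAlternating_apply (x : Fin 4 → E4) : rowDetAlternating x = rowDet x := rfl

theorem coneGauss_comp_perm (x : Fin 4 → E4) (σ : Equiv.Perm (Fin 4)) :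
    coneGauss (x ∘ σ) = coneGauss x := by
  have hmp := MeasureTheory.volume_measurePreserving_piCongrLeft (fun _ : Fin 4 => ℝ) σ
  have happ : ∀ (t : Fin 4 → ℝ) i,
      MeasurableEquiv.piCongrLeft (fun _ : Fin 4 => ℝ) σ t (σ i) = t i := fun t i =>
    MeasurableEquiv.piCongrLeft_apply_apply (β := fun _ : Fin 4 => ℝ) σ t i
  rw [coneGauss, coneGauss]
  conv_rhs => rw [← hmp.setIntegral_preimage_emb (MeasurableEquiv.measurableEmbedding _) _ (Ici 0)]
  have hset : MeasurableEquiv.piCongrLeft (fun _ : Fin 4 => ℝ) σ ⁻¹' Ici 0 = Ici 0 := by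
    ext t
    simp only [mem_preimage, mem_Ici, Pi.le_def, Pi.zero_apply]
    constructor
    · intro h i; rw [← happ t]; exact h _
    · intro h i
      obtain ⟨k, rfl⟩ := σ.surjective i
      rw [happ]; exact h k
  rw [hset]
  congr 1; funext t
  rw [← Equiv.sum_comp σ (fun i => MeasurableEquiv.piCongrLeft (fun _ : Fin 4 => ℝ) σ t i • x i)]
  simp only [happ, Function.comp_apply]

theorem coneVol_comp_perm (x : Fin 4 → E4) (σ : Equiv.Perm (Fin 4)) :
    coneVol (x ∘ σ) = Equiv.Perm.sign σ * coneVol x := by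
  rw [coneVol, coneVol, coneGauss_comp_perm, ← rowDetAlternating_apply, AlternatingMap.map_perm,
    rowDetAlternating_apply, Units.smul_def, zsmul_eq_mul, mul_assoc]

theorem rowDet_eq_zero_of_eq {x : Fin 4 → E4} {i j : Fin 4} (h : x i = x j) (hij : i ≠ j) :
    rowDet x = 0 := rowDetAlternating.map_eq_zero_of_eq x h hij

theorem coneVol_eq_zero_of_eq {x : Fin 4 → E4} {i j : Fin 4} (h : x i = x j) (hij : i ≠ j) :
    coneVol x = 0 := by rw [coneVol, rowDet_eq_zero_of_eq h hij, zero_mul]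

/-- Exchanging two pairs is an even permutation. This symmetry is the source of the factor two in
the linking number. -/
theorem coneVol_swap_pairs (a b c d : E4) : coneVol ![c, d, a, b] = coneVol ![a, b, c, d] := by
  have h := coneVol_comp_perm ![a, b, c, d] (Equiv.swap 0 2 * Equiv.swap 1 3)
  have h1 : (![a, b, c, d] : Fin 4 → E4) ∘ (Equiv.swap 0 2 * Equiv.swap 1 3 : Equiv.Perm (Fin 4)) =
      ![c, d, a, b] := by
    funext i; fin_cases i <;> rfl
  rw [h1, map_mul, Equiv.Perm.sign_swap (by decide), Equiv.Perm.sign_swap (by decide)] at h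
  simpa using h

theorem coneVol_rotate (u a b c : E4) : coneVol ![u, b, c, a] = coneVol ![u, a, b, c] := by
  have h := coneVol_comp_perm ![u, a, b, c] (Equiv.swap 1 2 * Equiv.swap 2 3)
  have h1 : (![u, a, b, c] : Fin 4 → E4) ∘ (Equiv.swap 1 2 * Equiv.swap 2 3 : Equiv.Perm (Fin 4)) =
      ![u, b, c, a] := by
    funext i; fin_cases i <;> rfl
  rw [h1, map_mul, Equiv.Perm.sign_swap (by decide), Equiv.Perm.sign_swap (by decide)] at h
  simpa using h

/-- No nontrivial nonnegative combination of the vectors vanishes. -/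
def PosIndep (x : Fin 4 → E4) : Prop := ∀ t : Fin 4 → ℝ, 0 ≤ t → ∑ i, t i • x i = 0 → t = 0

/-- The vector `u` is in general position with respect to the linearly independent family `x`. -/
def IsGenericFor (u : E4) (x : Fin 4 → E4) : Prop :=
  rowDet x ≠ 0 → ∀ i : Fin 4, rowDet (Fin.cons u (x ∘ i.succAbove)) ≠ 0

theorem rowDet_cons_succAbove_self (x : Fin 4 → E4) (i : Fin 4) (h : rowDet x ≠ 0) :
    rowDet (Fin.cons (x i) (x ∘ i.succAbove)) ≠ 0 := by
  have h1 : (Fin.cons (x i) (x ∘ i.succAbove) : Fin 4 → E4) = x ∘ i.cycleRange.symm := by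
    funext k
    refine Fin.cases ?_ (fun l => ?_) k
    · simp
    · simp [Fin.cycleRange_symm_succ]
  rw [h1, ← rowDetAlternating_apply, AlternatingMap.map_perm, rowDetAlternating_apply,
    Units.smul_def, zsmul_eq_mul]
  exact mul_ne_zero (by simp) h

/-- Finitely many proper subspaces do not cover the space. Each excluded kernel is proper because it
misses the omitted vector `x i`. -/
theorem exists_isGenericFor (S : Finset (Fin 4 → E4)) : ∃ u, ∀ x ∈ S, IsGenericFor u x := by
  classical
  let φ : (Fin 4 → E4) × Fin 4 → (E4 →ₗ[ℝ] ℝ) := fun p =>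
    rowDetAlternating.toMultilinearMap.toLinearMap (Fin.cons 0 (p.1 ∘ p.2.succAbove)) 0
  have hφ : ∀ p u, φ p u = rowDet (Fin.cons u (p.1 ∘ p.2.succAbove)) := by
    intro p u
    change rowDet (Function.update (Fin.cons 0 (p.1 ∘ p.2.succAbove)) 0 u) = _
    rw [Fin.update_cons_zero]
  let s : Finset (Subspace ℝ E4) :=
    ((S.filter fun x => rowDet x ≠ 0) ×ˢ Finset.univ).image fun p => LinearMap.ker (φ p)
  have hs : ⊤ ∉ s := by
    intro h
    obtain ⟨p, hp, hker⟩ := Finset.mem_image.1 h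
    simp only [Finset.mem_product, Finset.mem_filter, Finset.mem_univ, and_true] at hp
    have h0 : φ p (p.1 p.2) = 0 := by
      have : p.1 p.2 ∈ LinearMap.ker (φ p) := by rw [hker]; trivial
      exact this
    rw [hφ] at h0
    exact rowDet_cons_succAbove_self p.1 p.2 hp.2 h0
  have hne := Subspace.biUnion_ne_univ_of_top_notMem hs
  obtain ⟨u, hu⟩ := (ne_univ_iff_exists_notMem _).1 hne
  refine ⟨u, fun x hx hdet i h0 => hu ?_⟩
  simp only [mem_iUnion]
  refine ⟨LinearMap.ker (φ (x, i)), Finset.mem_image.2 ⟨(x, i), by simp [hx, hdet], rfl⟩, ?_⟩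
  exact (hφ (x, i) u).trans h0

/-- The subgroup of integers in `ℝ`. -/
abbrev intSubgroup : AddSubgroup ℝ := (Int.castAddHom ℝ).range

theorem mem_intSubgroup {r : ℝ} : r ∈ intSubgroup ↔ ∃ n : ℤ, r = n := by
  exact exists_congr fun n => eq_comm

/-- Apply the simplex lemma to `u` and `x`. If `x` is independent, genericity makes every Cramer
coefficient nonzero. If not, the coefficient of `u` vanishes, and `PosIndep` forbids a nontrivial
relation of constant sign among the rest. -/
theorem coneVol_add_sum_mem_int {u : E4} {x : Fin 4 → E4} (hu : IsGenericFor u x)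
    (hx : PosIndep x) :
    coneVol x - ∑ i : Fin 4, (-1) ^ (i : ℕ) * coneVol (Fin.cons u (x ∘ i.succAbove)) ∈
      intSubgroup := by
  set y : Fin 5 → E4 := Fin.cons u x with hy
  have hy0 : y ∘ (0 : Fin 5).succAbove = x := by
    funext k; simp [hy]
  have hys : ∀ i : Fin 4, y ∘ i.succ.succAbove = Fin.cons u (x ∘ i.succAbove) := by
    intro i; funext k
    refine Fin.cases ?_ (fun l => ?_) k
    · simp [hy]
    · simp [hy, Fin.succ_succAbove_succ]
  have hc0 : cramerCoeff y 0 = rowDet x := by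
    rw [cramerCoeff, hy0]; simp
  have hcs : ∀ i : Fin 4, cramerCoeff y i.succ =
      -((-1) ^ (i : ℕ) * rowDet (Fin.cons u (x ∘ i.succAbove))) := by
    intro i; rw [cramerCoeff, hys, Fin.val_succ, pow_succ]; ring
  have hne : rowDet x ≠ 0 → ∀ i, cramerCoeff y i ≠ 0 := by
    intro h i
    refine Fin.cases ?_ (fun k => ?_) i
    · rwa [hc0]
    · rw [hcs]
      exact neg_ne_zero.2 (mul_ne_zero (by simp) (hu h k))
  have hzero : rowDet x = 0 → ∑ i : Fin 4, cramerCoeff y i.succ • x i = 0 := by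
    intro h
    ext j
    have := sum_cramerCoeff y j
    rw [Fin.sum_univ_succ, hc0, h, zero_mul, zero_add] at this
    simpa [hy] using this
  obtain ⟨n, hn⟩ := sum_cramerCoeff_mul_coneGauss_mem_int y (by
    rintro h0 ⟨i, hi⟩ j
    by_cases hd : rowDet x = 0
    · exfalso
      have h1 := hx (fun i => cramerCoeff y i.succ) (fun i => h0 _) (hzero hd)
      revert hi
      refine Fin.cases ?_ (fun k => ?_) i
      · rw [hc0, hd]; exact lt_irrefl _
      · rw [show cramerCoeff y k.succ = 0 from congrFun h1 k]; exact lt_irrefl _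
    · exact lt_of_le_of_ne (h0 j) (hne hd j).symm) (by
    rintro h0 ⟨i, hi⟩ j
    by_cases hd : rowDet x = 0
    · exfalso
      have h1 := hx (fun i => -cramerCoeff y i.succ) (fun i => neg_nonneg.2 (h0 _)) (by
        simp only [neg_smul, Finset.sum_neg_distrib, hzero hd, neg_zero])
      revert hi
      refine Fin.cases ?_ (fun k => ?_) i
      · rw [hc0, hd]; exact lt_irrefl _
      · rw [show cramerCoeff y k.succ = 0 from neg_eq_zero.1 (congrFun h1 k)]
        exact lt_irrefl _
    · exact lt_of_le_of_ne (h0 j) (hne hd j))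
  refine mem_intSubgroup.2 ⟨n, ?_⟩
  rw [← hn, Fin.sum_univ_succ (n := 4), hc0, hy0, sub_eq_add_neg, ← Finset.sum_neg_distrib]
  congr 1
  refine Finset.sum_congr rfl fun i _ => ?_
  rw [hcs, hys, coneVol]; ring

theorem coneVol_sub_coboundary_mem_int {u a b c d : E4} (hu : IsGenericFor u ![a, b, c, d])
    (hx : PosIndep ![a, b, c, d]) :
    coneVol ![a, b, c, d] - (coneVol ![u, b, c, d] - coneVol ![u, a, c, d] + coneVol ![u, a, b, d] -
      coneVol ![u, a, b, c]) ∈ intSubgroup := by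
  have h := coneVol_add_sum_mem_int hu hx
  rw [Fin.sum_univ_four] at h
  have h0 : (Fin.cons u (![a, b, c, d] ∘ (0 : Fin 4).succAbove) : Fin 4 → E4) = ![u, b, c, d] := by
    funext i; fin_cases i <;> rfl
  have h1 : (Fin.cons u (![a, b, c, d] ∘ (1 : Fin 4).succAbove) : Fin 4 → E4) = ![u, a, c, d] := by
    funext i; fin_cases i <;> rfl
  have h2 : (Fin.cons u (![a, b, c, d] ∘ (2 : Fin 4).succAbove) : Fin 4 → E4) = ![u, a, b, d] := by
    funext i; fin_cases i <;> rfl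
  have h3 : (Fin.cons u (![a, b, c, d] ∘ (3 : Fin 4).succAbove) : Fin 4 → E4) = ![u, a, b, c] := by
    funext i; fin_cases i <;> rfl
  rw [h0, h1, h2, h3] at h
  convert h using 2
  simp
  ring

/-- The signed Gaussian volume of the join of two closed polygons is an integer. -/
theorem sum_coneVol_polygons_mem_int (x y : ℕ → E4) (N : ℕ) (hxN : x N = x 0) (hyN : y N = y 0)
    (h : ∀ i < N, ∀ j < N, PosIndep ![x i, x (i + 1), y j, y (j + 1)]) :
    ∑ i ∈ Finset.range N, ∑ j ∈ Finset.range N, coneVol ![x i, x (i + 1), y j, y (j + 1)] ∈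
      intSubgroup := by
  classical
  obtain ⟨u, hu⟩ := exists_isGenericFor ((Finset.range N ×ˢ Finset.range N).image
    fun p => ![x p.1, x (p.1 + 1), y p.2, y (p.2 + 1)])
  have hmem := sum_mem (S := intSubgroup) (t := Finset.range N) fun i hi =>
    sum_mem (S := intSubgroup) (t := Finset.range N) fun j hj =>
    coneVol_sub_coboundary_mem_int (hu _ (Finset.mem_image.2 ⟨(i, j), by simp_all, rfl⟩))
      (h i (Finset.mem_range.1 hi) j (Finset.mem_range.1 hj))
  simp only [Finset.sum_sub_distrib] at hmem
  convert hmem using 1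
  -- The coboundary telescopes along each closed polygon, so its total is zero.
  rw [eq_comm, sub_eq_self]
  simp only [add_sub_assoc, Finset.sum_add_distrib]
  have h1 : ∑ i ∈ Finset.range N, ∑ j ∈ Finset.range N,
      (coneVol ![u, x (i + 1), y j, y (j + 1)] - coneVol ![u, x i, y j, y (j + 1)]) = 0 := by
    rw [Finset.sum_comm]
    refine Finset.sum_eq_zero fun j _ => ?_
    rw [Finset.sum_range_sub (fun i => coneVol ![u, x i, y j, y (j + 1)]), hxN, sub_self]
  have h2 : ∑ i ∈ Finset.range N, ∑ j ∈ Finset.range N,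
      (coneVol ![u, x i, x (i + 1), y (j + 1)] - coneVol ![u, x i, x (i + 1), y j]) = 0 := by
    refine Finset.sum_eq_zero fun i _ => ?_
    rw [Finset.sum_range_sub (fun j => coneVol ![u, x i, x (i + 1), y j]), hyN, sub_self]
  simp only [Finset.sum_sub_distrib] at h1 h2 ⊢
  linarith

/-- Discrete Stokes formula on the triangle `i < j`: the diagonal side contributes nothing because
`W` vanishes on adjacent equal arguments, leaving the sides `i = 0` and `j = N`. -/
theorem sum_coboundary_triangle (W : E4 → E4 → E4 → ℝ) (hW : ∀ a b, W a a b = 0)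
    (hW' : ∀ a b, W a b b = 0) (x : ℕ → E4) (N : ℕ) :
    ∑ j ∈ Finset.range N, ∑ i ∈ Finset.range j, (W (x (i + 1)) (x j) (x (j + 1)) -
      W (x i) (x j) (x (j + 1)) + W (x i) (x (i + 1)) (x (j + 1)) - W (x i) (x (i + 1)) (x j)) =
    ∑ j ∈ Finset.range N, (W (x j) (x (j + 1)) (x N) - W (x 0) (x j) (x (j + 1))) := by
  induction N with
  | zero => simp
  | succ N ih =>
    rw [Finset.sum_range_succ, ih, Finset.sum_range_succ, hW']
    have h1 := Finset.sum_range_sub (fun i => W (x i) (x N) (x (N + 1))) N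
    simp only [Finset.sum_sub_distrib, Finset.sum_add_distrib, hW] at h1 ⊢
    linarith

theorem sum_sum_symm_eq_two_mul (f : ℕ → ℕ → ℝ) (hs : ∀ i j, f i j = f j i) (h0 : ∀ i, f i i = 0)
    (N : ℕ) : ∑ i ∈ Finset.range N, ∑ j ∈ Finset.range N, f i j =
      2 * ∑ j ∈ Finset.range N, ∑ i ∈ Finset.range j, f i j := by
  induction N with
  | zero => simp
  | succ N ih =>
    simp only [Finset.sum_range_succ, Finset.sum_add_distrib, ih, h0]
    rw [Finset.sum_congr rfl fun i _ => hs N i]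
    ring

/-- The signed Gaussian volume of the join of a closed polygon with itself is an even integer. -/
theorem exists_even_sum_coneVol_polygon (x : ℕ → E4) (N : ℕ) (hxN : x N = x 0)
    (h : ∀ i < N, ∀ j < N, PosIndep ![x i, x (i + 1), x j, x (j + 1)]) :
    ∃ n : ℤ, ∑ i ∈ Finset.range N, ∑ j ∈ Finset.range N,
      coneVol ![x i, x (i + 1), x j, x (j + 1)] = 2 * n := by
  classical
  obtain ⟨u, hu⟩ := exists_isGenericFor ((Finset.range N ×ˢ Finset.range N).image
    fun p => ![x p.1, x (p.1 + 1), x p.2, x (p.2 + 1)])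
  have hlt : ∀ {i j}, j ∈ Finset.range N → i ∈ Finset.range j → i < N ∧ j < N := by
    intro i j hj hi
    rw [Finset.mem_range] at hi hj
    exact ⟨hi.trans hj, hj⟩
  have hmem := sum_mem (S := intSubgroup) (t := Finset.range N) fun j hj =>
    sum_mem (S := intSubgroup) (t := Finset.range j) fun i hi =>
    coneVol_sub_coboundary_mem_int (a := x i) (b := x (i + 1)) (c := x j) (d := x (j + 1))
      (hu _ (Finset.mem_image.2 ⟨(i, j), by simp [hlt hj hi], rfl⟩))
      (h i (hlt hj hi).1 j (hlt hj hi).2)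
  have hT := sum_coboundary_triangle (fun a b c => coneVol ![u, a, b, c])
    (fun a b => coneVol_eq_zero_of_eq (i := 1) (j := 2) rfl (by decide))
    (fun a b => coneVol_eq_zero_of_eq (i := 2) (j := 3) rfl (by decide)) x N
  -- The two remaining sides cancel, since `x N = x 0` and a cyclic permutation of three vectors is
  -- even.
  replace hT := hT.trans (Finset.sum_eq_zero fun j _ => by rw [hxN, coneVol_rotate, sub_self])
  simp only [Finset.sum_sub_distrib] at hmem hT
  rw [hT, sub_zero] at hmem
  obtain ⟨n, hn⟩ := mem_intSubgroup.1 hmem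
  refine ⟨n, ?_⟩
  rw [← hn, sum_sum_symm_eq_two_mul (fun i j => coneVol ![x i, x (i + 1), x j, x (j + 1)])
    (fun i j => (coneVol_swap_pairs _ _ _ _).symm)
    (fun i => coneVol_eq_zero_of_eq (i := 0) (j := 2) rfl (by decide))]

/-! ### The Gauss integral of the join of two loops in four-space -/

theorem rowDet_four (a b c d : E4) : rowDet ![a, b, c, d] =
    a 0 * (b 1 * (c 2 * d 3 - c 3 * d 2) - b 2 * (c 1 * d 3 - c 3 * d 1) +
      b 3 * (c 1 * d 2 - c 2 * d 1)) -
    a 1 * (b 0 * (c 2 * d 3 - c 3 * d 2) - b 2 * (c 0 * d 3 - c 3 * d 0) +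
      b 3 * (c 0 * d 2 - c 2 * d 0)) +
    a 2 * (b 0 * (c 1 * d 3 - c 3 * d 1) - b 1 * (c 0 * d 3 - c 3 * d 0) +
      b 3 * (c 0 * d 1 - c 1 * d 0)) -
    a 3 * (b 0 * (c 1 * d 2 - c 2 * d 1) - b 1 * (c 0 * d 2 - c 2 * d 0) +
      b 2 * (c 0 * d 1 - c 1 * d 0)) := by
  rw [rowDet, Matrix.det_succ_row_zero]
  simp only [Matrix.det_fin_three, Fin.sum_univ_four, Matrix.submatrix_apply, Matrix.of_apply]
  simp [Fin.succAbove, Fin.lt_def]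
  ring

/-- The determinant ignores the repeated rows; the factor `h ^ 2` is the area element of the Riemann
sums. -/
theorem rowDet_add_smul (a b p q : E4) (h : ℝ) :
    rowDet ![a, a + h • p, b, b + h • q] = h ^ 2 * rowDet ![a, p, b, q] := by
  simp only [rowDet_four, PiLp.add_apply, PiLp.smul_apply, smul_eq_mul]
  ring

theorem continuous_rowDet : Continuous rowDet := by
  unfold rowDet
  refine Continuous.matrix_det (continuous_matrix fun i j => ?_)
  simp only [Matrix.of_apply]
  fun_prop

theorem ContinuousAt.vec_four {α : Type*} [TopologicalSpace α] {a b c d : α → E4} {p : α}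
    (ha : ContinuousAt a p) (hb : ContinuousAt b p) (hc : ContinuousAt c p)
    (hd : ContinuousAt d p) : ContinuousAt (fun p => ![a p, b p, c p, d p]) p := by
  refine continuousAt_pi.2 fun i => ?_
  fin_cases i
  · exact ha
  · exact hb
  · exact hc
  · exact hd

/-- Compactness of the standard simplex gives a positive minimum, and half of it survives small
perturbations. Both openness of `PosIndep` and domination of the Gaussian integrals follow. -/
theorem PosIndep.exists_lower_bound {x : Fin 4 → E4} (hx : PosIndep x) :
    ∃ δ > 0, ∀ᶠ y in nhds x, ∀ t : Fin 4 → ℝ, 0 ≤ t → δ * ∑ i, t i ≤ ‖∑ i, t i • y i‖ := by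
  obtain ⟨t₀, ht₀, hmin⟩ := (isCompact_stdSimplex ℝ (Fin 4)).exists_isMinOn
    ⟨_, single_mem_stdSimplex ℝ (0 : Fin 4)⟩
    (f := fun t : Fin 4 → ℝ => ‖∑ i, t i • x i‖) (by fun_prop)
  set m := ‖∑ i, t₀ i • x i‖ with hm
  have hm0 : 0 < m := by
    rw [hm, norm_pos_iff]
    intro h
    have := hx t₀ ht₀.1 h
    have h2 := ht₀.2
    rw [this] at h2
    simp at h2
  refine ⟨m / 2, by positivity, ?_⟩
  filter_upwards [Metric.ball_mem_nhds x (half_pos hm0)] with y hy t ht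
  have h1 : m * ∑ i, t i ≤ ‖∑ i, t i • x i‖ := by
    have hs : 0 ≤ ∑ i, t i := Finset.sum_nonneg fun i _ => ht i
    rcases hs.eq_or_lt with h0 | h0
    · rw [← h0, mul_zero]; exact norm_nonneg _
    · have := hmin (a := fun i => (∑ i, t i)⁻¹ * t i)
        ⟨fun i => mul_nonneg (inv_nonneg.2 hs) (ht i), by
          rw [← Finset.mul_sum, inv_mul_cancel₀ h0.ne']⟩
      simp only [mem_ofPred_eq, mul_smul, ← Finset.smul_sum, norm_smul, norm_inv,
        Real.norm_of_nonneg hs] at this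
      rw [inv_mul_eq_div, le_div_iff₀ h0] at this
      exact this
  have h2 : ‖∑ i, t i • x i‖ - ‖∑ i, t i • y i‖ ≤ m / 2 * ∑ i, t i := by
    refine (norm_sub_norm_le _ _).trans ?_
    rw [← Finset.sum_sub_distrib, Finset.mul_sum]
    refine (norm_sum_le _ _).trans (Finset.sum_le_sum fun i _ => ?_)
    rw [← smul_sub, norm_smul, Real.norm_of_nonneg (ht i), mul_comm, ← dist_eq_norm, dist_comm]
    exact mul_le_mul_of_nonneg_right ((dist_le_pi_dist y x i).trans (mem_ball.1 hy).le) (ht i)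
  linarith

theorem PosIndep.eventually {x : Fin 4 → E4} (hx : PosIndep x) : ∀ᶠ y in nhds x, PosIndep y := by
  obtain ⟨δ, hδ, h⟩ := hx.exists_lower_bound
  filter_upwards [h] with y hy t ht h0
  have h1 := hy t ht
  rw [h0, norm_zero] at h1
  have h2 : ∑ i, t i = 0 := le_antisymm
    (by by_contra h'; push Not at h'; have := mul_pos hδ h'; linarith)
    (Finset.sum_nonneg fun i _ => ht i)
  rw [Finset.sum_eq_zero_iff_of_nonneg fun i _ => ht i] at h2
  exact funext fun i => h2 i (Finset.mem_univ i)

/-- Dominated convergence. Linear independence is not required, which matters because in the limit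
the vectors coincide in pairs. -/
theorem PosIndep.continuousAt_coneGauss {x : Fin 4 → E4} (hx : PosIndep x) :
    ContinuousAt coneGauss x := by
  obtain ⟨δ, hδ, h⟩ := hx.exists_lower_bound
  unfold coneGauss
  refine MeasureTheory.continuousAt_of_dominated
    (bound := fun t : Fin 4 → ℝ => ∏ i, Real.exp (-(Real.pi * δ ^ 2) * t i ^ 2))
    (Filter.Eventually.of_forall fun y => ?_) ?_ ?_
    (Filter.Eventually.of_forall fun t => ?_)
  · exact Continuous.aestronglyMeasurable (by fun_prop)
  · filter_upwards [h] with y hy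
    refine (MeasureTheory.ae_restrict_mem measurableSet_Ici).mono fun t ht => ?_
    rw [Real.norm_of_nonneg (Real.exp_nonneg _), ← Real.exp_sum, Real.exp_le_exp,
      ← Finset.mul_sum, neg_mul, neg_le_neg_iff, mul_assoc]
    refine mul_le_mul_of_nonneg_left ?_ Real.pi_nonneg
    have hs : 0 ≤ ∑ i, t i := Finset.sum_nonneg fun i _ => ht i
    have h1 : ∑ i, t i ^ 2 ≤ (∑ i, t i) ^ 2 := by
      rw [sq (∑ i, t i), Finset.sum_mul]
      refine Finset.sum_le_sum fun i _ => ?_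
      rw [sq]
      exact mul_le_mul_of_nonneg_left
        (Finset.single_le_sum (fun j _ => ht j) (Finset.mem_univ i)) (ht i)
    calc δ ^ 2 * ∑ i, t i ^ 2 ≤ δ ^ 2 * (∑ i, t i) ^ 2 :=
          mul_le_mul_of_nonneg_left h1 (sq_nonneg _)
      _ = (δ * ∑ i, t i) ^ 2 := by ring
      _ ≤ _ := pow_le_pow_left₀ (by positivity) (hy t ht) 2
  · refine MeasureTheory.Integrable.restrict ?_
    exact MeasureTheory.Integrable.fintype_prod fun i =>
      integrable_exp_neg_mul_sq (by have := Real.pi_pos; positivity)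
  · exact Continuous.continuousAt (by fun_prop)

theorem abs_integral_sub_sum_le {F : ℝ → ℝ} (hF : Continuous F) {T ε : ℝ} (hT : 0 < T)
    {N : ℕ} (hN : 0 < N) (c : ℕ → ℝ)
    (h : ∀ j < N, ∀ t ∈ Icc (j * (T / N)) ((j + 1) * (T / N)), |F t - c j| ≤ ε) :
    |(∫ t in (0 : ℝ)..T, F t) - ∑ j ∈ Finset.range N, T / N * c j| ≤ T * ε := by
  have hN' : (0 : ℝ) < N := Nat.cast_pos.2 hN
  have hh : 0 < T / N := by positivity
  have h1 := intervalIntegral.sum_integral_adjacent_intervals (f := F)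
    (μ := MeasureTheory.volume) (a := fun j : ℕ => (j : ℝ) * (T / N)) (n := N)
    (fun k _ => hF.intervalIntegrable _ _)
  simp only [Nat.cast_zero, zero_mul, mul_div_cancel₀ T hN'.ne'] at h1
  rw [← h1, ← Finset.sum_sub_distrib]
  refine (Finset.abs_sum_le_sum_abs _ _).trans ?_
  have h2 : ∀ j ∈ Finset.range N, |(∫ t in (j * (T / N))..((j + 1 : ℕ) * (T / N)), F t) -
      T / N * c j| ≤ ε * (T / N) := by
    intro j hj
    have hlen : ((j + 1 : ℕ) : ℝ) * (T / N) - j * (T / N) = T / N := by push_cast; ring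
    have h3 : T / N * c j = ∫ t in (j * (T / N))..((j + 1 : ℕ) * (T / N)), c j := by
      rw [intervalIntegral.integral_const, hlen, smul_eq_mul]
    rw [h3, ← intervalIntegral.integral_sub (hF.intervalIntegrable _ _) (by simp)]
    have h4 := intervalIntegral.norm_integral_le_of_norm_le_const
      (f := fun t => F t - c j) (C := ε) (a := j * (T / N)) (b := (j + 1 : ℕ) * (T / N)) (by
        intro t ht
        rw [uIoc_of_le (by linarith)] at ht
        exact h j (Finset.mem_range.1 hj) t ⟨ht.1.le, by simpa using ht.2⟩)
    rwa [hlen, abs_of_pos hh] at h4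
  refine (Finset.sum_le_sum h2).trans (le_of_eq ?_)
  rw [Finset.sum_const, Finset.card_range, nsmul_eq_mul]
  field_simp

/-- A Riemann sum whose integrand also depends on the mesh `T / N`. Continuity at mesh zero
suffices, being uniform near the compact set `{0} × [0, T]²`. -/
theorem tendsto_sum_sum_integral (G : ℝ → ℝ → ℝ → ℝ) {T : ℝ} (hT : 0 < T)
    (hG : ∀ s ∈ Icc 0 T, ∀ t ∈ Icc 0 T,
      ContinuousAt (fun p : ℝ × ℝ × ℝ => G p.1 p.2.1 p.2.2) (0, s, t))
    (hG0 : Continuous fun p : ℝ × ℝ => G 0 p.1 p.2) :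
    Filter.Tendsto (fun N : ℕ => ∑ i ∈ Finset.range N, ∑ j ∈ Finset.range N,
      (T / N) ^ 2 * G (T / N) (i * (T / N)) (j * (T / N))) Filter.atTop
      (nhds (∫ s in (0 : ℝ)..T, ∫ t in (0 : ℝ)..T, G 0 s t)) := by
  rw [Metric.tendsto_atTop]
  intro ε hε
  set ε' := ε / (2 * T ^ 2) with hε'
  have hε'0 : 0 < ε' := by positivity
  have hK : IsCompact (({0} : Set ℝ) ×ˢ (Icc 0 T ×ˢ Icc 0 T)) :=
    isCompact_singleton.prod (isCompact_Icc.prod isCompact_Icc)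
  have hu := hK.uniformContinuousAt_of_continuousAt
    (fun p : ℝ × ℝ × ℝ => G p.1 p.2.1 p.2.2) (by
      rintro ⟨h, s, t⟩ ⟨rfl, hs, ht⟩; exact hG s hs t ht) (Metric.dist_mem_uniformity hε'0)
  obtain ⟨δ, hδ, hu⟩ := Metric.mem_uniformity_dist.1 hu
  obtain ⟨N₀, hN₀⟩ := exists_nat_gt (T / δ)
  refine ⟨N₀ + 1, fun N hN => ?_⟩
  have hNpos : 0 < N := by omega
  have hN' : (0 : ℝ) < N := Nat.cast_pos.2 hNpos
  have hh : 0 < T / N := by positivity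
  have hhδ : T / N < δ := by
    rw [div_lt_iff₀ hN']
    rw [div_lt_iff₀ hδ] at hN₀
    have : (N₀ : ℝ) < N := by exact_mod_cast (by omega : N₀ < N)
    nlinarith
  have hmem : ∀ j < N, ∀ t ∈ Icc ((j : ℝ) * (T / N)) ((j + 1) * (T / N)),
      t ∈ Icc 0 T ∧ dist t (j * (T / N)) < δ := by
    intro j hj t ht
    have hj' : (j : ℝ) + 1 ≤ N := by exact_mod_cast hj
    have h1 : ((j : ℝ) + 1) * (T / N) ≤ T := by
      calc ((j : ℝ) + 1) * (T / N) ≤ N * (T / N) := mul_le_mul_of_nonneg_right hj' hh.le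
        _ = T := mul_div_cancel₀ T hN'.ne'
    refine ⟨⟨le_trans (by positivity) ht.1, ht.2.trans h1⟩, ?_⟩
    rw [Real.dist_eq, abs_of_nonneg (sub_nonneg.2 ht.1)]
    linarith [ht.2]
  have hinner : ∀ i < N, ∀ s ∈ Icc ((i : ℝ) * (T / N)) ((i + 1) * (T / N)),
      |(∫ t in (0 : ℝ)..T, G 0 s t) -
        ∑ j ∈ Finset.range N, T / N * G (T / N) (i * (T / N)) (j * (T / N))| ≤ T * ε' := by
    intro i hi s hs
    refine abs_integral_sub_sum_le (F := fun t => G 0 s t)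
      (hG0.comp (Continuous.prodMk continuous_const continuous_id)) hT hNpos
      (fun j => G (T / N) (i * (T / N)) (j * (T / N))) fun j hj t ht => ?_
    obtain ⟨hs1, hs2⟩ := hmem i hi s hs
    obtain ⟨ht1, ht2⟩ := hmem j hj t ht
    have := hu (a := ((0 : ℝ), s, t)) (b := (T / N, i * (T / N), j * (T / N))) (by
      rw [Prod.dist_eq, Prod.dist_eq, max_lt_iff, max_lt_iff]
      refine ⟨?_, hs2, ht2⟩
      rw [Real.dist_eq, zero_sub, abs_neg, abs_of_pos hh]; exact hhδ) ⟨rfl, hs1, ht1⟩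
    exact (Real.dist_eq _ _ ▸ (mem_ofPred_eq ▸ this : dist _ _ < ε')).le
  have houter := abs_integral_sub_sum_le (F := fun s => ∫ t in (0 : ℝ)..T, G 0 s t)
    (intervalIntegral.continuous_parametric_intervalIntegral_of_continuous' hG0 0 T) hT hNpos
    (fun i => ∑ j ∈ Finset.range N, T / N * G (T / N) (i * (T / N)) (j * (T / N))) hinner
  rw [dist_comm, Real.dist_eq]
  simp only [Finset.mul_sum, ← mul_assoc, ← sq] at houter ⊢
  refine houter.trans_lt ?_
  have : T ^ 2 * ε' = ε / 2 := by rw [hε']; field_simp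
  rw [this]; linarith

/-! ### Joins of loops: integrality, evenness and homotopy invariance -/

/-- No nontrivial nonnegative combination of a point of `X` and a point of `Y` vanishes. -/
def JoinIndep (X Y : ℝ → E4) : Prop :=
  ∀ s t a b : ℝ, 0 ≤ a → 0 ≤ b → a • X s + b • Y t = 0 → a = 0 ∧ b = 0

theorem JoinIndep.posIndep {X Y : ℝ → E4} (h : JoinIndep X Y) (s t : ℝ) :
    PosIndep ![X s, X s, Y t, Y t] := by
  intro c hc h0
  rw [Fin.sum_univ_four] at h0
  have h1 := h s t (c 0 + c 1) (c 2 + c 3) (add_nonneg (hc 0) (hc 1)) (add_nonneg (hc 2) (hc 3))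
    (by rw [← h0, add_smul, add_smul, ← add_assoc]; rfl)
  have e0 := hc 0
  have e1 := hc 1
  have e2 := hc 2
  have e3 := hc 3
  simp only [Pi.zero_apply] at e0 e1 e2 e3
  funext i
  fin_cases i
  · change c 0 = 0; linarith [h1.1]
  · change c 1 = 0; linarith [h1.1]
  · change c 2 = 0; linarith [h1.2]
  · change c 3 = 0; linarith [h1.2]

/-- The integrand of `joinIntegral`. -/
def joinKernel (X Y : ℝ → E4) (s t : ℝ) : ℝ :=
  rowDet ![X s, deriv X s, Y t, deriv Y t] * coneGauss ![X s, X s, Y t, Y t]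

/-- The degree, as a Gaussian integral, of the join of two loops of period `T` in `ℝ⁴ ∖ {0}`. -/
def joinIntegral (X Y : ℝ → E4) (T : ℝ) : ℝ :=
  ∫ s in (0 : ℝ)..T, ∫ t in (0 : ℝ)..T, joinKernel X Y s t

/-- The difference quotient of a differentiable curve, extended by the derivative. -/
def diffQuot (X : ℝ → E4) (h s : ℝ) : E4 := ∫ r in (0 : ℝ)..1, deriv X (s + r * h)

theorem diffQuot_zero (X : ℝ → E4) (s : ℝ) : diffQuot X 0 s = deriv X s := by
  simp [diffQuot]

theorem continuous_diffQuot {X : ℝ → E4} (hX : ContDiff ℝ 1 X) :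
    Continuous fun p : ℝ × ℝ => diffQuot X p.1 p.2 := by
  have hd : Continuous (deriv X) := hX.continuous_deriv le_rfl
  exact intervalIntegral.continuous_parametric_intervalIntegral_of_continuous' (by fun_prop) 0 1

theorem add_smul_diffQuot {X : ℝ → E4} (hX : ContDiff ℝ 1 X) (h s : ℝ) :
    X s + h • diffQuot X h s = X (s + h) := by
  have hd : Continuous (deriv X) := hX.continuous_deriv le_rfl
  have hder : ∀ r ∈ uIcc (0 : ℝ) 1,
      HasDerivAt (fun r => X (s + r * h)) (h • deriv X (s + r * h)) r := by
    intro r _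
    have h1 : HasDerivAt (fun r => s + r * h) h r := by
      simpa using ((hasDerivAt_id r).mul_const h).const_add s
    exact ((hX.differentiable one_ne_zero _).hasDerivAt).scomp r h1
  have := intervalIntegral.integral_eq_sub_of_hasDerivAt hder
    (Continuous.intervalIntegrable (by fun_prop) _ _)
  rw [diffQuot, ← intervalIntegral.integral_smul, this]
  simp

/-- Exhibits each polygonal cone volume as the area element times a function that extends
continuously to `h = 0`, where it is `joinKernel`. -/
theorem coneVol_eq_sq_mul {X Y : ℝ → E4} (hX : ContDiff ℝ 1 X) (hY : ContDiff ℝ 1 Y) (h s t : ℝ) :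
    coneVol ![X s, X (s + h), Y t, Y (t + h)] =
      h ^ 2 * (rowDet ![X s, diffQuot X h s, Y t, diffQuot Y h t] *
        coneGauss ![X s, X (s + h), Y t, Y (t + h)]) := by
  rw [coneVol, ← mul_assoc, ← rowDet_add_smul, add_smul_diffQuot hX, add_smul_diffQuot hY]

theorem JoinIndep.tendsto_sum_coneVol {X Y : ℝ → E4} (h : JoinIndep X Y) (hX : ContDiff ℝ 1 X)
    (hY : ContDiff ℝ 1 Y) {T : ℝ} (hT : 0 < T) :
    Filter.Tendsto (fun N : ℕ => ∑ i ∈ Finset.range N, ∑ j ∈ Finset.range N,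
      coneVol ![X (i * (T / N)), X ((i + 1 : ℕ) * (T / N)), Y (j * (T / N)),
        Y ((j + 1 : ℕ) * (T / N))]) Filter.atTop (nhds (joinIntegral X Y T)) := by
  have hXc := hX.continuous
  have hYc := hY.continuous
  have hdX : Continuous (deriv X) := hX.continuous_deriv le_rfl
  have hdY : Continuous (deriv Y) := hY.continuous_deriv le_rfl
  have hqX := continuous_diffQuot hX
  have hqY := continuous_diffQuot hY
  have hG0 : ∀ s t, rowDet ![X s, diffQuot X 0 s, Y t, diffQuot Y 0 t] *
      coneGauss ![X s, X (s + 0), Y t, Y (t + 0)] = joinKernel X Y s t := by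
    intro s t; rw [diffQuot_zero, diffQuot_zero, add_zero, add_zero, joinKernel]
  have hGat : ∀ s t, ContinuousAt (fun p : ℝ × ℝ × ℝ =>
      rowDet ![X p.2.1, diffQuot X p.1 p.2.1, Y p.2.2, diffQuot Y p.1 p.2.2] *
        coneGauss ![X p.2.1, X (p.2.1 + p.1), Y p.2.2, Y (p.2.2 + p.1)]) (0, s, t) := by
    intro s t
    refine ContinuousAt.mul ?_ ?_
    · refine continuous_rowDet.continuousAt.comp (ContinuousAt.vec_four ?_ ?_ ?_ ?_)
      · exact Continuous.continuousAt (by fun_prop)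
      · exact (hqX.comp (continuous_fst.prodMk continuous_snd.fst)).continuousAt
      · exact Continuous.continuousAt (by fun_prop)
      · exact (hqY.comp (continuous_fst.prodMk continuous_snd.snd)).continuousAt
    · refine ContinuousAt.comp (f := fun p : ℝ × ℝ × ℝ =>
        ![X p.2.1, X (p.2.1 + p.1), Y p.2.2, Y (p.2.2 + p.1)]) (g := coneGauss) ?_
        (ContinuousAt.vec_four ?_ ?_ ?_ ?_)
      · simp only [add_zero]
        exact (h.posIndep s t).continuousAt_coneGauss
      all_goals exact Continuous.continuousAt (by fun_prop)
  have hcont : Continuous fun p : ℝ × ℝ => rowDet ![X p.1, diffQuot X 0 p.1, Y p.2,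
      diffQuot Y 0 p.2] * coneGauss ![X p.1, X (p.1 + 0), Y p.2, Y (p.2 + 0)] := by
    refine continuous_iff_continuousAt.2 fun ⟨s, t⟩ => ?_
    exact (hGat s t).comp (f := fun p : ℝ × ℝ => ((0 : ℝ), p.1, p.2)) (x := (s, t))
      (Continuous.continuousAt (by fun_prop))
  have key := tendsto_sum_sum_integral (fun h s t =>
    rowDet ![X s, diffQuot X h s, Y t, diffQuot Y h t] *
      coneGauss ![X s, X (s + h), Y t, Y (t + h)]) hT (fun s _ t _ => hGat s t) hcont
  simp only [hG0, ← coneVol_eq_sq_mul hX hY] at key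
  refine key.congr fun N => Finset.sum_congr rfl fun i _ => Finset.sum_congr rfl fun j _ => ?_
  push_cast
  rw [add_mul, add_mul, one_mul]

theorem JoinIndep.eventually_posIndep {X Y : ℝ → E4} (h : JoinIndep X Y) (hX : Continuous X)
    (hY : Continuous Y) {T : ℝ} (hT : 0 < T) :
    ∀ᶠ N : ℕ in Filter.atTop, ∀ i < N, ∀ j < N,
      PosIndep ![X (i * (T / N)), X ((i + 1 : ℕ) * (T / N)), Y (j * (T / N)),
        Y ((j + 1 : ℕ) * (T / N))] := by
  have hK : IsCompact (Icc (0 : ℝ) T ×ˢ Icc (0 : ℝ) T) := isCompact_Icc.prod isCompact_Icc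
  have h1 := hK.eventually_forall_of_forall_eventually (x₀ := (0 : ℝ))
    (P := fun h p => PosIndep ![X p.1, X (p.1 + h), Y p.2, Y (p.2 + h)]) (by
      rintro ⟨s, t⟩ -
      have hc : ContinuousAt (fun p : ℝ × ℝ × ℝ =>
          ![X p.2.1, X (p.2.1 + p.1), Y p.2.2, Y (p.2.2 + p.1)]) (0, s, t) := by
        refine ContinuousAt.vec_four ?_ ?_ ?_ ?_
        all_goals exact Continuous.continuousAt (by fun_prop)
      refine hc.eventually (PosIndep.eventually ?_)
      simp only [add_zero]
      exact h.posIndep s t)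
  have h2 : Filter.Tendsto (fun N : ℕ => T / N) Filter.atTop (nhds 0) :=
    tendsto_const_div_atTop_nhds_zero_nat T
  filter_upwards [h2.eventually h1] with N hN i hi j hj
  have hN' : (0 : ℝ) < N := Nat.cast_pos.2 (by omega)
  have hmem : ∀ k < N, (k : ℝ) * (T / N) ∈ Icc 0 T := by
    intro k hk
    refine ⟨by positivity, ?_⟩
    rw [← mul_div_assoc, div_le_iff₀ hN', mul_comm]
    exact mul_le_mul_of_nonneg_left (Nat.cast_le.2 hk.le) hT.le
  have := hN (i * (T / N), j * (T / N)) ⟨hmem i hi, hmem j hj⟩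
  push_cast
  rw [add_mul, add_mul, one_mul]
  exact this

theorem isClosed_intSubgroup : IsClosed (intSubgroup : Set ℝ) := by
  rw [AddMonoidHom.coe_range]
  exact Int.isClosedEmbedding_coe_real.isClosed_range

theorem periodic_polygon_closed {X : ℝ → E4} {T : ℝ} (hX : X.Periodic T) {N : ℕ} (hN : 0 < N) :
    X (N * (T / N)) = X ((0 : ℕ) * (T / N)) := by
  rw [mul_div_cancel₀ T (Nat.cast_pos.2 hN).ne', Nat.cast_zero, zero_mul]
  simpa using hX 0

/-- The degree of the join of two loops is an integer. -/
theorem JoinIndep.joinIntegral_mem_int {X Y : ℝ → E4} (h : JoinIndep X Y) (hX : ContDiff ℝ 1 X)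
    (hY : ContDiff ℝ 1 Y) {T : ℝ} (hT : 0 < T) (hXp : X.Periodic T) (hYp : Y.Periodic T) :
    joinIntegral X Y T ∈ intSubgroup := by
  refine isClosed_intSubgroup.mem_of_tendsto (h.tendsto_sum_coneVol hX hY hT) ?_
  filter_upwards [h.eventually_posIndep hX.continuous hY.continuous hT,
    Filter.eventually_gt_atTop 0] with N hN hN0
  exact sum_coneVol_polygons_mem_int (fun i => X (i * (T / N))) (fun j => Y (j * (T / N))) N
    (periodic_polygon_closed hXp hN0) (periodic_polygon_closed hYp hN0) hN

/-- The degree of the join of a loop with itself is an even integer. -/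
theorem JoinIndep.exists_joinIntegral_self_eq {X : ℝ → E4} (h : JoinIndep X X)
    (hX : ContDiff ℝ 1 X) {T : ℝ} (hT : 0 < T) (hXp : X.Periodic T) :
    ∃ n : ℤ, joinIntegral X X T = 2 * n := by
  have hlim := (h.tendsto_sum_coneVol hX hX hT).const_mul (1 / 2)
  -- Half of each polygonal sum is an integer, and the integers are closed in the reals.
  have hmem : 1 / 2 * joinIntegral X X T ∈ intSubgroup := by
    refine isClosed_intSubgroup.mem_of_tendsto hlim ?_
    filter_upwards [h.eventually_posIndep hX.continuous hX.continuous hT,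
      Filter.eventually_gt_atTop 0] with N hN hN0
    obtain ⟨n, hn⟩ := exists_even_sum_coneVol_polygon (fun i => X (i * (T / N))) N
      (periodic_polygon_closed hXp hN0) hN
    exact mem_intSubgroup.2 ⟨n, by rw [hn]; ring⟩
  obtain ⟨n, hn⟩ := mem_intSubgroup.1 hmem
  exact ⟨n, by rw [← hn]; ring⟩

theorem continuous_joinKernel_family {X Y : ℝ → ℝ → E4} {X' Y' : ℝ → ℝ → E4}
    (hX : Continuous fun p : ℝ × ℝ => X p.1 p.2) (hY : Continuous fun p : ℝ × ℝ => Y p.1 p.2)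
    (hX' : Continuous fun p : ℝ × ℝ => X' p.1 p.2) (hY' : Continuous fun p : ℝ × ℝ => Y' p.1 p.2)
    (h : ∀ r, JoinIndep (X r) (Y r)) :
    Continuous fun p : ℝ × ℝ × ℝ => rowDet ![X p.1 p.2.1, X' p.1 p.2.1, Y p.1 p.2.2, Y' p.1 p.2.2] *
      coneGauss ![X p.1 p.2.1, X p.1 p.2.1, Y p.1 p.2.2, Y p.1 p.2.2] := by
  have e1 : Continuous fun p : ℝ × ℝ × ℝ => (p.1, p.2.1) := by fun_prop
  have e2 : Continuous fun p : ℝ × ℝ × ℝ => (p.1, p.2.2) := by fun_prop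
  refine continuous_iff_continuousAt.2 fun p => ContinuousAt.mul ?_ ?_
  · exact continuous_rowDet.continuousAt.comp (ContinuousAt.vec_four (hX.comp e1).continuousAt
      (hX'.comp e1).continuousAt (hY.comp e2).continuousAt (hY'.comp e2).continuousAt)
  · exact ContinuousAt.comp (f := fun p : ℝ × ℝ × ℝ =>
        ![X p.1 p.2.1, X p.1 p.2.1, Y p.1 p.2.2, Y p.1 p.2.2]) (g := coneGauss)
      ((h p.1).posIndep _ _).continuousAt_coneGauss
      (ContinuousAt.vec_four (hX.comp e1).continuousAt (hX.comp e1).continuousAt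
        (hY.comp e2).continuousAt (hY.comp e2).continuousAt)

/-- The linear homotopy between two curves. -/
def lineHomotopy (X₀ X₁ : ℝ → E4) (r s : ℝ) : E4 := (1 - r) • X₀ s + r • X₁ s

theorem deriv_lineHomotopy {X₀ X₁ : ℝ → E4} (h₀ : ContDiff ℝ 1 X₀) (h₁ : ContDiff ℝ 1 X₁)
    (r s : ℝ) : deriv (lineHomotopy X₀ X₁ r) s = (1 - r) • deriv X₀ s + r • deriv X₁ s := by
  have e0 := (h₀.differentiable one_ne_zero s).hasDerivAt
  have e1 := (h₁.differentiable one_ne_zero s).hasDerivAt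
  exact ((e0.const_smul (1 - r)).add (e1.const_smul r)).deriv

/-- The degree of the join is invariant under linear homotopies. -/
theorem joinIntegral_eq_of_lineHomotopy {X₀ X₁ Y₀ Y₁ : ℝ → E4} {T : ℝ} (hT : 0 < T)
    (hX₀ : ContDiff ℝ 1 X₀) (hX₁ : ContDiff ℝ 1 X₁) (hY₀ : ContDiff ℝ 1 Y₀)
    (hY₁ : ContDiff ℝ 1 Y₁) (pX₀ : X₀.Periodic T) (pX₁ : X₁.Periodic T) (pY₀ : Y₀.Periodic T)
    (pY₁ : Y₁.Periodic T)
    (h : ∀ r ∈ Icc (0 : ℝ) 1, JoinIndep (lineHomotopy X₀ X₁ r) (lineHomotopy Y₀ Y₁ r)) :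
    joinIntegral X₀ Y₀ T = joinIntegral X₁ Y₁ T := by
  -- Clamping the parameter to `[0, 1]` makes the integer-valued function `f` continuous on the
  -- whole line, hence constant.
  set c : ℝ → ℝ := fun r => (projIcc (0 : ℝ) 1 zero_le_one r : ℝ) with hc
  have hcc : Continuous c := continuous_subtype_val.comp continuous_projIcc
  have hcm : ∀ r, c r ∈ Icc (0 : ℝ) 1 := fun r => (projIcc (0 : ℝ) 1 zero_le_one r).2
  set f : ℝ → ℝ := fun r =>
    joinIntegral (lineHomotopy X₀ X₁ (c r)) (lineHomotopy Y₀ Y₁ (c r)) T with hf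
  have hd : ∀ {X : ℝ → E4}, ContDiff ℝ 1 X → Continuous (deriv X) :=
    fun hX => hX.continuous_deriv le_rfl
  have c1 := hX₀.continuous
  have c2 := hX₁.continuous
  have c3 := hY₀.continuous
  have c4 := hY₁.continuous
  have d1 := hd hX₀
  have d2 := hd hX₁
  have d3 := hd hY₀
  have d4 := hd hY₁
  have hcont : Continuous f := by
    have hk := continuous_joinKernel_family
      (X := fun r => lineHomotopy X₀ X₁ (c r)) (Y := fun r => lineHomotopy Y₀ Y₁ (c r))
      (X' := fun r s => deriv (lineHomotopy X₀ X₁ (c r)) s)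
      (Y' := fun r s => deriv (lineHomotopy Y₀ Y₁ (c r)) s)
      (by unfold lineHomotopy; fun_prop) (by unfold lineHomotopy; fun_prop)
      (by simp only [deriv_lineHomotopy hX₀ hX₁]; fun_prop)
      (by simp only [deriv_lineHomotopy hY₀ hY₁]; fun_prop) (fun r => h _ (hcm r))
    refine intervalIntegral.continuous_parametric_intervalIntegral_of_continuous' ?_ 0 T
    refine intervalIntegral.continuous_parametric_intervalIntegral_of_continuous'
      (f := fun (p : ℝ × ℝ) t => joinKernel (lineHomotopy X₀ X₁ (c p.1))
        (lineHomotopy Y₀ Y₁ (c p.1)) p.2 t) ?_ 0 T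
    exact hk.comp (f := fun q : (ℝ × ℝ) × ℝ => (q.1.1, q.1.2, q.2)) (by fun_prop)
  have hint : ∀ r, ∃ n : ℤ, f r = n := fun r => mem_intSubgroup.1 <|
    (h _ (hcm r)).joinIntegral_mem_int (by unfold lineHomotopy; fun_prop)
      (by unfold lineHomotopy; fun_prop) hT
      (fun s => by simp only [lineHomotopy, pX₀ s, pX₁ s])
      (fun s => by simp only [lineHomotopy, pY₀ s, pY₁ s])
  choose g hg using hint
  have hgc : Continuous g := by
    rw [Int.isClosedEmbedding_coe_real.isInducing.continuous_iff]
    exact hcont.congr hg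
  have h01 : g 0 = g 1 := PreconnectedSpace.constant inferInstance hgc
  have hf0 : f 0 = joinIntegral X₀ Y₀ T := by
    have : c 0 = 0 := by simp [hc]
    simp only [hf, this]
    congr 1 <;> (funext s; simp [lineHomotopy])
  have hf1 : f 1 = joinIntegral X₁ Y₁ T := by
    have : c 1 = 1 := by simp [hc]
    simp only [hf, this]
    congr 1 <;> (funext s; simp [lineHomotopy])
  rw [← hf0, ← hf1, hg, hg, h01]

/-! ### The limit of the join kernel for vertically stretched curves -/

theorem lintegral_pi_cons {n : ℕ} {f : (Fin (n + 1) → ℝ) → ENNReal} (hf : Measurable f) :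
    ∫⁻ t, f t = ∫⁻ a : ℝ, ∫⁻ t : Fin n → ℝ, f (Fin.cons a t) := by
  have h := (MeasureTheory.volume_preserving_piFinSuccAbove (fun _ : Fin (n + 1) => ℝ) 0).symm
  rw [← h.lintegral_comp_emb (MeasurableEquiv.measurableEmbedding _)]
  rw [MeasureTheory.Measure.volume_eq_prod, MeasureTheory.lintegral_prod
    (fun p => f ((MeasurableEquiv.piFinSuccAbove (fun _ : Fin (n + 1) => ℝ) 0).symm p))
    (hf.comp (MeasurableEquiv.measurable _)).aemeasurable]
  refine MeasureTheory.lintegral_congr fun a => MeasureTheory.lintegral_congr fun t => ?_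
  congr 1
  exact Fin.insertNth_zero' a t

/-- For fixed sum `m`, the admissible `a` fill `[0, m]`, whose length is the weight. -/
theorem lintegral_orthant_add {f : ℝ → ENNReal} (hf : Measurable f) :
    ∫⁻ a : ℝ, ∫⁻ b : ℝ, (Ici (0 : ℝ)).indicator 1 a * (Ici (0 : ℝ)).indicator 1 b * f (a + b) =
      ∫⁻ m : ℝ, ENNReal.ofReal m * f m := by
  have h1 : ∀ a : ℝ, ∫⁻ b : ℝ, (Ici (0 : ℝ)).indicator 1 a * (Ici (0 : ℝ)).indicator 1 b * f (a + b) =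
      ∫⁻ m : ℝ, (Icc 0 m).indicator 1 a * f m := by
    intro a
    rw [← MeasureTheory.lintegral_add_left_eq_self (fun m => (Icc 0 m).indicator 1 a * f m) a]
    congr 1; funext b
    congr 1
    simp only [indicator_apply, mem_Ici, mem_Icc, Pi.one_apply]
    by_cases ha : 0 ≤ a <;> by_cases hb : 0 ≤ b <;> simp [ha, hb]
  have hm : Measurable fun p : ℝ × ℝ => (Icc 0 p.2).indicator (1 : ℝ → ENNReal) p.1 := by
    have : (fun p : ℝ × ℝ => (Icc 0 p.2).indicator (1 : ℝ → ENNReal) p.1) =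
        {p : ℝ × ℝ | 0 ≤ p.1 ∧ p.1 ≤ p.2}.indicator 1 := by
      funext p; simp [indicator_apply]
    rw [this]
    exact measurable_one.indicator ((measurableSet_le measurable_const measurable_fst).inter
      (measurableSet_le measurable_fst measurable_snd))
  simp only [h1]
  rw [MeasureTheory.lintegral_lintegral_swap
    (hm.mul (hf.comp measurable_snd)).aemeasurable]
  congr 1; funext m
  have hm' : Measurable fun a => (Icc 0 m).indicator (1 : ℝ → ENNReal) a :=
    measurable_one.indicator measurableSet_Icc
  rw [MeasureTheory.lintegral_mul_const _ hm', MeasureTheory.lintegral_indicator_one measurableSet_Icc,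
    Real.volume_Icc, sub_zero]

theorem lintegral_orthant_four {F : ℝ × ℝ → ENNReal} (hF : Measurable F) :
    ∫⁻ t in Ici (0 : Fin 4 → ℝ), F (t 0 + t 1, t 2 + t 3) =
      ∫⁻ m : ℝ, ∫⁻ n : ℝ, ENNReal.ofReal m * (ENNReal.ofReal n * F (m, n)) := by
  set I : ℝ → ENNReal := (Ici (0 : ℝ)).indicator 1 with hI
  have hIm : Measurable I := measurable_one.indicator measurableSet_Ici
  have h1 : ∫⁻ t in Ici (0 : Fin 4 → ℝ), F (t 0 + t 1, t 2 + t 3) =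
      ∫⁻ t : Fin 4 → ℝ, I (t 0) * I (t 1) * (I (t 2) * I (t 3) * F (t 0 + t 1, t 2 + t 3)) := by
    rw [← MeasureTheory.lintegral_indicator measurableSet_Ici]
    congr 1; funext t
    have ht : t ∈ Ici (0 : Fin 4 → ℝ) ↔ 0 ≤ t 0 ∧ 0 ≤ t 1 ∧ 0 ≤ t 2 ∧ 0 ≤ t 3 := by
      refine ⟨fun h => ⟨h 0, h 1, h 2, h 3⟩, fun ⟨h0, h1, h2, h3⟩ i => ?_⟩
      fin_cases i <;> assumption
    classical
    rw [indicator_apply]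
    simp only [ht]
    simp only [hI, indicator_apply, mem_Ici, Pi.one_apply]
    by_cases h0 : 0 ≤ t 0 <;> by_cases h1 : 0 ≤ t 1 <;> by_cases h2 : 0 ≤ t 2 <;>
      by_cases h3 : 0 ≤ t 3 <;> simp [h0, h1, h2, h3]
  have hF2 : ∀ m, Measurable fun n => F (m, n) := fun m => hF.comp measurable_prodMk_left
  rw [h1, lintegral_pi_cons (by fun_prop)]
  have h2 : ∀ a : ℝ, ∫⁻ t : Fin 3 → ℝ, I ((Fin.cons a t : Fin 4 → ℝ) 0) *
      I ((Fin.cons a t : Fin 4 → ℝ) 1) * (I ((Fin.cons a t : Fin 4 → ℝ) 2) *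
      I ((Fin.cons a t : Fin 4 → ℝ) 3) * F ((Fin.cons a t : Fin 4 → ℝ) 0 +
      (Fin.cons a t : Fin 4 → ℝ) 1, (Fin.cons a t : Fin 4 → ℝ) 2 + (Fin.cons a t : Fin 4 → ℝ) 3)) =
      ∫⁻ b : ℝ, I a * I b * ∫⁻ n : ℝ, ENNReal.ofReal n * F (a + b, n) := by
    intro a
    change ∫⁻ t : Fin 3 → ℝ, I a * I (t 0) * (I (t 1) * I (t 2) * F (a + t 0, t 1 + t 2)) = _
    rw [lintegral_pi_cons (by fun_prop)]
    congr 1; funext b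
    change ∫⁻ t : Fin 2 → ℝ, I a * I b * (I (t 0) * I (t 1) * F (a + b, t 0 + t 1)) = _
    rw [MeasureTheory.lintegral_const_mul _ (by fun_prop), ← lintegral_orthant_add (hF2 _),
      lintegral_pi_cons (by fun_prop)]
    congr 2; funext c
    change ∫⁻ t : Fin 1 → ℝ, I c * I (t 0) * F (a + b, c + t 0) = _
    rw [lintegral_pi_cons (by fun_prop)]
    congr 1; funext d
    have hv : MeasureTheory.volume (univ : Set (Fin 0 → ℝ)) = 1 := by
      simp [MeasureTheory.volume_pi]
    simp [hv, hI]
  simp only [h2]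
  have hmeas : Measurable fun m => ∫⁻ n : ℝ, ENNReal.ofReal n * F (m, n) :=
    Measurable.lintegral_prod_right' (f := fun p : ℝ × ℝ => ENNReal.ofReal p.2 * F p) (by fun_prop)
  rw [lintegral_orthant_add hmeas]
  congr 1; funext m
  rw [MeasureTheory.lintegral_const_mul _ (by have := hF2 m; fun_prop)]

theorem lintegral_eq_mul_lintegral_affine {f : ℝ → ENNReal} (hf : Measurable f) (n : ℝ) {e : ℝ}
    (he : 0 < e) : ∫⁻ m, f m = ENNReal.ofReal e * ∫⁻ y, f (n + e * y) := by
  rw [← MeasureTheory.lintegral_add_left_eq_self f n]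
  have h := Real.map_volume_mul_left he.ne'
  have h2 : ∫⁻ y, f (n + e * y) = ENNReal.ofReal |e⁻¹| * ∫⁻ m, f (n + m) := by
    rw [← smul_eq_mul, ← MeasureTheory.lintegral_smul_measure, ← h,
      MeasureTheory.lintegral_map (by fun_prop) (by fun_prop)]
  rw [h2, ← mul_assoc, abs_of_pos (inv_pos.2 he), ← ENNReal.ofReal_mul he.le,
    mul_inv_cancel₀ he.ne', ENNReal.ofReal_one, one_mul]

/-- The integrand of the stretched join kernel, with stretching factor `1 / e`. -/
def stretchIntegrand (e : ℝ) (c d : E4) (p : ℝ × ℝ) : ℝ :=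
  max (p.1 + e * p.2) 0 * max p.1 0 *
    Real.exp (-(Real.pi * (‖p.1 • (c - d) + (e * p.2) • c‖ ^ 2 + p.2 ^ 2)))

theorem stretchIntegrand_nonneg (e : ℝ) (c d : E4) (p : ℝ × ℝ) : 0 ≤ stretchIntegrand e c d p := by
  unfold stretchIntegrand; positivity

theorem continuous_stretchIntegrand (e : ℝ) (c d : E4) : Continuous (stretchIntegrand e c d) := by
  unfold stretchIntegrand; fun_prop

theorem norm_sq_stretch {v c d : E4} (hv : ‖v‖ = 1) (hc : inner ℝ v c = 0) (hd : inner ℝ v d = 0)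
    {e : ℝ} (he : 0 < e) (n y : ℝ) :
    ‖(n + e * y) • (c - e⁻¹ • v) + n • (e⁻¹ • v - d)‖ ^ 2 =
      ‖n • (c - d) + (e * y) • c‖ ^ 2 + y ^ 2 := by
  have h : (n + e * y) • (c - e⁻¹ • v) + n • (e⁻¹ • v - d) =
      (n • (c - d) + (e * y) • c) - y • v := by
    have : y • v = (e * y * e⁻¹) • v := by rw [mul_right_comm, mul_inv_cancel₀ he.ne', one_mul]
    rw [this]; module
  have h0 : inner ℝ (n • (c - d) + (e * y) • c) (y • v) = 0 := by
    rw [real_inner_comm, inner_smul_left, inner_add_right, inner_smul_right, inner_smul_right,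
      inner_sub_right, hc, hd]
    simp
  rw [h, @norm_sub_sq ℝ, h0, norm_smul, hv]
  simp

/-- Equal vectors reduce the four variables to the sums `m`, `n` with density `m n`. The
substitution `m = n + e y` has Jacobian `e` and splits off the component `-y v`, which is orthogonal
to the rest. -/
theorem coneGauss_stretch {v c d : E4} (hv : ‖v‖ = 1) (hc : inner ℝ v c = 0)
    (hd : inner ℝ v d = 0) {e : ℝ} (he : 0 < e) :
    coneGauss ![c - e⁻¹ • v, c - e⁻¹ • v, e⁻¹ • v - d, e⁻¹ • v - d] =
      e * ∫ p, stretchIntegrand e c d p := by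
  set F : ℝ × ℝ → ℝ := fun p =>
    Real.exp (-(Real.pi * ‖p.1 • (c - e⁻¹ • v) + p.2 • (e⁻¹ • v - d)‖ ^ 2)) with hF
  have hFc : Continuous F := by fun_prop
  have h1 : coneGauss ![c - e⁻¹ • v, c - e⁻¹ • v, e⁻¹ • v - d, e⁻¹ • v - d] =
      ∫ t in Ici (0 : Fin 4 → ℝ), F (t 0 + t 1, t 2 + t 3) := by
    rw [coneGauss]
    congr 1; funext t
    simp only [hF]
    congr 5
    rw [Fin.sum_univ_four, add_smul, add_smul, ← add_assoc]; rfl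
  rw [h1, MeasureTheory.integral_eq_lintegral_of_nonneg_ae
    (Filter.Eventually.of_forall fun t => Real.exp_nonneg _)
    (Continuous.aestronglyMeasurable (by fun_prop)),
    MeasureTheory.integral_eq_lintegral_of_nonneg_ae
    (Filter.Eventually.of_forall fun t => stretchIntegrand_nonneg e c d t)
    (continuous_stretchIntegrand e c d).aestronglyMeasurable,
    lintegral_orthant_four (F := fun p => ENNReal.ofReal (F p))
      (ENNReal.measurable_ofReal.comp hFc.measurable)]
  rw [show ∀ x : ENNReal, e * x.toReal = (ENNReal.ofReal e * x).toReal from fun x => by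
    rw [ENNReal.toReal_mul, ENNReal.toReal_ofReal he.le]]
  congr 1
  have hmeas : Measurable fun p : ℝ × ℝ =>
      ENNReal.ofReal p.1 * (ENNReal.ofReal p.2 * ENNReal.ofReal (F p)) := by
    have := hFc.measurable
    fun_prop
  rw [MeasureTheory.lintegral_lintegral_swap hmeas.aemeasurable,
    MeasureTheory.Measure.volume_eq_prod, MeasureTheory.lintegral_prod
      (fun p => ENNReal.ofReal (stretchIntegrand e c d p))
      (ENNReal.measurable_ofReal.comp (continuous_stretchIntegrand e c d).measurable).aemeasurable,
    ← MeasureTheory.lintegral_const_mul _ (Measurable.lintegral_prod_right'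
      (f := fun p : ℝ × ℝ => ENNReal.ofReal (stretchIntegrand e c d p))
      (ENNReal.measurable_ofReal.comp (continuous_stretchIntegrand e c d).measurable))]
  congr 1; funext n
  rw [lintegral_eq_mul_lintegral_affine
    (f := fun x => ENNReal.ofReal x * (ENNReal.ofReal n * ENNReal.ofReal (F (x, n))))
    (hmeas.comp (measurable_id.prodMk measurable_const)) n he]
  congr 2; funext y
  simp only [stretchIntegrand, hF]
  rw [norm_sq_stretch hv hc hd he, ENNReal.ofReal_mul (by positivity),
    ENNReal.ofReal_mul (by positivity), ← mul_assoc]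
  congr 2
  -- `ENNReal.ofReal` truncates negative values, as the maxima in `stretchIntegrand` do.
  · rw [ENNReal.ofReal_max, ENNReal.ofReal_zero, max_eq_left zero_le]
  · rw [ENNReal.ofReal_max, ENNReal.ofReal_zero, max_eq_left zero_le]

/-- An integrable majorant of the stretched join kernels. -/
def stretchBound (r : ℝ) (p : ℝ × ℝ) : ℝ :=
  p.1 ^ 2 * Real.exp (-(Real.pi * r ^ 2 / 2) * p.1 ^ 2) * Real.exp (-(Real.pi / 2) * p.2 ^ 2) +
  |p.1 * Real.exp (-(Real.pi * r ^ 2 / 2) * p.1 ^ 2)| * |p.2 * Real.exp (-(Real.pi / 2) * p.2 ^ 2)|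

theorem integrable_sq_mul_exp_neg_mul_sq {b : ℝ} (hb : 0 < b) :
    MeasureTheory.Integrable fun x : ℝ => x ^ 2 * Real.exp (-b * x ^ 2) := by
  have := integrable_rpow_mul_exp_neg_mul_sq hb (s := 2) (by norm_num)
  simpa using this

theorem integrable_stretchBound {r : ℝ} (hr : 0 < r) :
    MeasureTheory.Integrable (stretchBound r) := by
  have hb : 0 < Real.pi * r ^ 2 / 2 := by have := Real.pi_pos; positivity
  have hb' : 0 < Real.pi / 2 := by have := Real.pi_pos; positivity
  refine MeasureTheory.Integrable.add ?_ ?_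
  · exact (integrable_sq_mul_exp_neg_mul_sq hb).mul_prod (integrable_exp_neg_mul_sq hb')
  · exact (integrable_mul_exp_neg_mul_sq hb).abs.mul_prod (integrable_mul_exp_neg_mul_sq hb').abs

/-- Use `‖p‖² ≤ 2‖p + q‖² + 2‖q‖²`; the bound on `e ‖c‖` lets half of the Gaussian exponent in `y`
absorb the error term. -/
theorem stretchIntegrand_le {r e : ℝ} (hr : 0 < r) {c d : E4} (hcd : r ≤ ‖c - d‖) (he : 0 ≤ e)
    (he1 : e ≤ 1) (hec : (e * ‖c‖) ^ 2 ≤ 1 / 2) (p : ℝ × ℝ) :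
    stretchIntegrand e c d p ≤ stretchBound r p := by
  obtain ⟨n, y⟩ := p
  have h1 : max (n + e * y) 0 * max n 0 ≤ n ^ 2 + |n| * |y| := by
    have e1 : max (n + e * y) 0 ≤ |n| + |y| := by
      refine max_le ?_ (by positivity)
      refine add_le_add (le_abs_self n) ((le_abs_self _).trans ?_)
      rw [abs_mul, abs_of_nonneg he]
      exact mul_le_of_le_one_left (abs_nonneg _) he1
    have e2 : max n 0 ≤ |n| := max_le (le_abs_self n) (abs_nonneg _)
    calc max (n + e * y) 0 * max n 0 ≤ (|n| + |y|) * |n| :=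
          mul_le_mul e1 e2 (le_max_right _ _) (by positivity)
      _ = n ^ 2 + |n| * |y| := by rw [add_mul, ← sq, sq_abs, mul_comm |y|]
  have h2 : n ^ 2 * r ^ 2 / 2 + y ^ 2 / 2 ≤ ‖n • (c - d) + (e * y) • c‖ ^ 2 + y ^ 2 := by
    set p := n • (c - d) with hp
    set q := (e * y) • c with hq
    have a1 : ‖p‖ ≤ ‖p + q‖ + ‖q‖ := by
      have := norm_sub_le (p + q) q
      rwa [add_sub_cancel_right] at this
    have a2 : ‖p‖ ^ 2 ≤ 2 * ‖p + q‖ ^ 2 + 2 * ‖q‖ ^ 2 := by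
      have := pow_le_pow_left₀ (norm_nonneg p) a1 2
      nlinarith [sq_nonneg (‖p + q‖ - ‖q‖)]
    have a3 : n ^ 2 * r ^ 2 ≤ ‖p‖ ^ 2 := by
      rw [hp, norm_smul, mul_pow, Real.norm_eq_abs, sq_abs]
      exact mul_le_mul_of_nonneg_left (pow_le_pow_left₀ hr.le hcd 2) (sq_nonneg n)
    have a4 : ‖q‖ ^ 2 ≤ y ^ 2 / 2 := by
      have : ‖q‖ ^ 2 = (e * ‖c‖) ^ 2 * y ^ 2 := by
        rw [hq, norm_smul, Real.norm_eq_abs, mul_pow, sq_abs]; ring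
      rw [this]; nlinarith [sq_nonneg y]
    linarith
  have h3 : Real.exp (-(Real.pi * (‖n • (c - d) + (e * y) • c‖ ^ 2 + y ^ 2))) ≤
      Real.exp (-(Real.pi * r ^ 2 / 2) * n ^ 2) * Real.exp (-(Real.pi / 2) * y ^ 2) := by
    rw [← Real.exp_add, Real.exp_le_exp]
    have := mul_le_mul_of_nonneg_left h2 Real.pi_nonneg
    linarith
  calc stretchIntegrand e c d (n, y) ≤ (n ^ 2 + |n| * |y|) *
        (Real.exp (-(Real.pi * r ^ 2 / 2) * n ^ 2) * Real.exp (-(Real.pi / 2) * y ^ 2)) :=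
        mul_le_mul h1 h3 (Real.exp_nonneg _) (by positivity)
    _ = stretchBound r (n, y) := by
        simp only [stretchBound, abs_mul, Real.abs_exp]; ring

theorem integral_stretchIntegrand_le {r e : ℝ} (hr : 0 < r) {c d : E4} (hcd : r ≤ ‖c - d‖)
    (he : 0 ≤ e) (he1 : e ≤ 1) (hec : (e * ‖c‖) ^ 2 ≤ 1 / 2) :
    |∫ p, stretchIntegrand e c d p| ≤ ∫ p, stretchBound r p := by
  rw [abs_of_nonneg (MeasureTheory.integral_nonneg (stretchIntegrand_nonneg e c d))]
  exact MeasureTheory.integral_mono_of_nonneg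
    (Filter.Eventually.of_forall (stretchIntegrand_nonneg e c d)) (integrable_stretchBound hr)
    (Filter.Eventually.of_forall (stretchIntegrand_le hr hcd he he1 hec))

/-- At `e = 0` the variables separate into a second Gaussian moment on the half-line and a Gaussian
of mass one. This produces both the constant `4π` and the cube in Gauss's kernel. -/
theorem integral_stretchIntegrand_zero {c d : E4} (hcd : c ≠ d) :
    ∫ p, stretchIntegrand 0 c d p = 1 / (4 * Real.pi * ‖c - d‖ ^ 3) := by
  have hr : 0 < ‖c - d‖ := norm_pos_iff.2 (sub_ne_zero.2 hcd)
  set r := ‖c - d‖ with hr'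
  have hpi := Real.pi_pos
  have h1 : ∀ p : ℝ × ℝ, stretchIntegrand 0 c d p =
      ((Ioi (0 : ℝ)).indicator (fun x => x ^ (2 : ℝ) * Real.exp (-(Real.pi * r ^ 2) * x ^ (2 : ℝ)))
        p.1) * Real.exp (-Real.pi * p.2 ^ 2) := by
    rintro ⟨n, y⟩
    simp only [stretchIntegrand, zero_mul, add_zero, zero_smul, norm_smul, Real.norm_eq_abs,
      mul_pow, sq_abs, ← hr']
    rw [mul_add, neg_add, Real.exp_add, ← mul_assoc, neg_mul]
    congr 1
    by_cases hn : 0 < n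
    · rw [indicator_of_mem (mem_Ioi.2 hn), max_eq_left hn.le]
      norm_num
      ring_nf
    · rw [indicator_of_notMem (by simpa using hn), max_eq_right (not_lt.1 hn)]
      simp
  simp only [h1]
  rw [MeasureTheory.Measure.volume_eq_prod, MeasureTheory.integral_prod_mul
    (fun x : ℝ => (Ioi (0 : ℝ)).indicator (fun x => x ^ (2 : ℝ) *
      Real.exp (-(Real.pi * r ^ 2) * x ^ (2 : ℝ))) x) (fun y : ℝ => Real.exp (-Real.pi * y ^ 2)),
    MeasureTheory.integral_indicator measurableSet_Ioi, integral_gaussian,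
    integral_rpow_mul_exp_neg_mul_rpow (by norm_num) (by norm_num) (by positivity),
    div_self hpi.ne', Real.sqrt_one, mul_one]
  have h2 : Real.Gamma ((2 + 1) / 2) = 1 / 2 * √Real.pi := by
    rw [← Real.Gamma_one_half_eq, ← Real.Gamma_add_one (by norm_num)]
    norm_num
  have h3 : (Real.pi * r ^ 2) ^ (-(2 + 1) / 2 : ℝ) = (Real.pi * √Real.pi * r ^ 3)⁻¹ := by
    rw [show (-(2 + 1) / 2 : ℝ) = -(1 + 1 / 2) by norm_num, Real.rpow_neg (by positivity),
      Real.rpow_add (by positivity), Real.rpow_one, ← Real.sqrt_eq_rpow,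
      Real.sqrt_mul hpi.le, Real.sqrt_sq hr.le]
    congr 1; ring
  rw [h2, h3]
  have : √Real.pi ≠ 0 := (Real.sqrt_pos.2 hpi).ne'
  field_simp
  norm_num

theorem tendsto_integral_stretchIntegrand {c d : E4} (hcd : c ≠ d) :
    Filter.Tendsto (fun e => ∫ p, stretchIntegrand e c d p) (nhdsWithin 0 (Ioi 0))
      (nhds (1 / (4 * Real.pi * ‖c - d‖ ^ 3))) := by
  have hr : 0 < ‖c - d‖ := norm_pos_iff.2 (sub_ne_zero.2 hcd)
  rw [← integral_stretchIntegrand_zero hcd]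
  refine MeasureTheory.tendsto_integral_filter_of_dominated_convergence (stretchBound ‖c - d‖)
    (Filter.Eventually.of_forall fun e => (continuous_stretchIntegrand e c d).aestronglyMeasurable)
    ?_ (integrable_stretchBound hr) (Filter.Eventually.of_forall fun p => ?_)
  · have h1 : ∀ᶠ e : ℝ in nhdsWithin 0 (Ioi 0), e ≤ 1 :=
      (eventually_le_nhds one_pos).filter_mono nhdsWithin_le_nhds
    have h2 : ∀ᶠ e : ℝ in nhdsWithin 0 (Ioi 0), (e * ‖c‖) ^ 2 ≤ 1 / 2 := by
      have hc : ContinuousAt (fun e : ℝ => (e * ‖c‖) ^ 2) 0 :=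
        Continuous.continuousAt (by fun_prop)
      exact (hc.eventually (eventually_le_nhds (by norm_num))).filter_mono nhdsWithin_le_nhds
    filter_upwards [h1, h2, self_mem_nhdsWithin] with e he1 he2 he0
    refine Filter.Eventually.of_forall fun p => ?_
    rw [Real.norm_of_nonneg (stretchIntegrand_nonneg e c d p)]
    exact stretchIntegrand_le hr le_rfl (mem_Ioi.1 he0).le he1 he2 p
  · have hc : Continuous fun e => stretchIntegrand e c d p := by
      unfold stretchIntegrand; fun_prop
    exact (hc.tendsto 0).mono_left nhdsWithin_le_nhds

/-! ### Gauss's integral as a degree -/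

/-- The terms without `v` form the determinant of four vectors in the hyperplane orthogonal to `v`,
which vanishes; the rest is linear in `h`. -/
theorem rowDet_stretch {v c d c' d' : E4} (hv : v ≠ 0) (hc : inner ℝ v c = 0)
    (hd : inner ℝ v d = 0) (hc' : inner ℝ v c' = 0) (hd' : inner ℝ v d' = 0) (h : ℝ) :
    rowDet ![c - h • v, c', h • v - d, -d'] = h * rowDet ![-v, c - d, c', d'] := by
  have h0 : rowDet ![c, c', d, d'] = 0 := by
    rw [rowDet]
    refine Matrix.exists_mulVec_eq_zero_iff.1 ⟨WithLp.ofLp v, fun h => hv (by ext i; exact congrFun h i), ?_⟩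
    have key : ∀ w : E4, inner ℝ v w = 0 → ∑ j, w j * v j = 0 := by
      intro w hw
      rw [PiLp.inner_apply] at hw
      simpa [mul_comm] using hw
    funext i
    fin_cases i
    · exact key c hc
    · exact key c' hc'
    · exact key d hd
    · exact key d' hd'
  rw [← sub_eq_zero, ← h0]
  simp only [rowDet_four, PiLp.sub_apply, PiLp.smul_apply, PiLp.neg_apply, smul_eq_mul]
  ring

theorem JoinIndep.continuous_joinKernel {X Y : ℝ → E4} (h : JoinIndep X Y) (hX : ContDiff ℝ 1 X)
    (hY : ContDiff ℝ 1 Y) : Continuous fun p : ℝ × ℝ => joinKernel X Y p.1 p.2 := by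
  have hdX : Continuous (deriv X) := hX.continuous_deriv le_rfl
  have hdY : Continuous (deriv Y) := hY.continuous_deriv le_rfl
  have hXc := hX.continuous
  have hYc := hY.continuous
  exact (continuous_joinKernel_family (X := fun _ => X) (Y := fun _ => Y) (X' := fun _ => deriv X)
    (Y' := fun _ => deriv Y) (by fun_prop) (by fun_prop) (by fun_prop) (by fun_prop)
    (fun _ => h)).comp (f := fun p : ℝ × ℝ => ((0 : ℝ), p.1, p.2)) (by fun_prop)

/-- If all vertical stretchings of two disjoint loops in the hyperplane orthogonal to `v` have the
same degree, then this degree is given by Gauss's linking integral. -/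
theorem gauss_integral_eq_of_stretch {v : E4} (hv : ‖v‖ = 1) {c d : ℝ → E4} (hc : ContDiff ℝ 1 c)
    (hd : ContDiff ℝ 1 d) (hvc : ∀ s, inner ℝ v (c s) = 0) (hvd : ∀ t, inner ℝ v (d t) = 0)
    {T : ℝ} (hT : 0 < T) (hne : ∀ s t, c s ≠ d t) {l e₀ : ℝ} (he₀ : 0 < e₀)
    (hJ : ∀ e : ℝ, 0 < e → JoinIndep (fun s => c s - e⁻¹ • v) (fun t => e⁻¹ • v - d t))
    (hl : ∀ e : ℝ, 0 < e → e ≤ e₀ →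
      joinIntegral (fun s => c s - e⁻¹ • v) (fun t => e⁻¹ • v - d t) T = l) :
    1 / (4 * Real.pi) * ∫ s in (0 : ℝ)..T, ∫ t in (0 : ℝ)..T,
      rowDet ![-v, c s - d t, deriv c s, deriv d t] / ‖c s - d t‖ ^ 3 = l := by
  have hcc := hc.continuous
  have hdc := hd.continuous
  have hdc' : Continuous (deriv c) := hc.continuous_deriv le_rfl
  have hdd' : Continuous (deriv d) := hd.continuous_deriv le_rfl
  have hv0 : v ≠ 0 := by rw [← norm_pos_iff, hv]; exact one_pos
  have hperp : ∀ {w : ℝ → E4}, ContDiff ℝ 1 w → (∀ s, inner ℝ v (w s) = 0) →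
      ∀ s, inner ℝ v (deriv w s) = 0 := by
    intro w hw h s
    have h1 := (hasDerivAt_const s v).inner ℝ (hw.differentiable one_ne_zero s).hasDerivAt
    simp only [h, inner_zero_left, add_zero] at h1
    exact h1.unique (hasDerivAt_const s (0 : ℝ))
  set D : ℝ → ℝ → ℝ := fun s t => rowDet ![-v, c s - d t, deriv c s, deriv d t] with hD
  have hDc : Continuous fun p : ℝ × ℝ => D p.1 p.2 := by
    refine continuous_iff_continuousAt.2 fun p => continuous_rowDet.continuousAt.comp
      (ContinuousAt.vec_four ?_ ?_ ?_ ?_)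
    all_goals exact Continuous.continuousAt (by fun_prop)
  -- The factor `e⁻¹` of the determinant cancels the factor `e` of the Gaussian integral.
  have hker : ∀ e, 0 < e → ∀ s t, joinKernel (fun s => c s - e⁻¹ • v) (fun t => e⁻¹ • v - d t) s t =
      D s t * ∫ p, stretchIntegrand e (c s) (d t) p := by
    intro e he s t
    have e1 : deriv (fun s => c s - e⁻¹ • v) s = deriv c s := by rw [deriv_sub_const]
    have e2 : deriv (fun t => e⁻¹ • v - d t) t = -deriv d t := by rw [deriv_const_sub]
    rw [joinKernel, e1, e2, rowDet_stretch hv0 (hvc s) (hvd t) (hperp hc hvc s) (hperp hd hvd t),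
      coneGauss_stretch hv (hvc s) (hvd t) he, mul_mul_mul_comm, inv_mul_cancel₀ he.ne', one_mul]
  have hKc : ∀ e, 0 < e → Continuous fun p : ℝ × ℝ =>
      D p.1 p.2 * ∫ q, stretchIntegrand e (c p.1) (d p.2) q := by
    intro e he
    simp only [← hker e he]
    exact (hJ e he).continuous_joinKernel (by fun_prop) (by fun_prop)
  have hI : ∀ e, 0 < e → e ≤ e₀ → (∫ s in (0 : ℝ)..T, ∫ t in (0 : ℝ)..T,
      D s t * ∫ q, stretchIntegrand e (c s) (d t) q) = l := by
    intro e he he'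
    rw [← hl e he he', joinIntegral]
    simp only [hker e he]
  have hK : IsCompact (Icc (0 : ℝ) T ×ˢ Icc (0 : ℝ) T) := isCompact_Icc.prod isCompact_Icc
  have hKne : (Icc (0 : ℝ) T ×ˢ Icc (0 : ℝ) T).Nonempty :=
    ⟨(0, 0), ⟨left_mem_Icc.2 hT.le, left_mem_Icc.2 hT.le⟩⟩
  obtain ⟨⟨s₀, t₀⟩, -, hmin⟩ := hK.exists_isMinOn hKne
    (f := fun p : ℝ × ℝ => ‖c p.1 - d p.2‖) (by fun_prop)
  set r := ‖c s₀ - d t₀‖ with hr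
  have hr0 : 0 < r := norm_pos_iff.2 (sub_ne_zero.2 (hne _ _))
  have hrle : ∀ s ∈ Icc 0 T, ∀ t ∈ Icc 0 T, r ≤ ‖c s - d t‖ := fun s hs t ht =>
    hmin (a := (s, t)) ⟨hs, ht⟩
  obtain ⟨R, hR⟩ := isCompact_Icc.exists_bound_of_continuousOn (f := c) (s := Icc 0 T)
    hcc.continuousOn
  obtain ⟨B, hB⟩ := hK.exists_bound_of_continuousOn hDc.continuousOn
  set C := B * ∫ p, stretchBound r p with hC
  have hsmall : ∀ᶠ e : ℝ in nhdsWithin 0 (Ioi 0), 0 < e ∧ e ≤ 1 ∧ e ≤ e₀ ∧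
      (e * R) ^ 2 ≤ 1 / 2 := by
    have h1 : ∀ᶠ e : ℝ in nhdsWithin 0 (Ioi 0), e ≤ 1 :=
      (eventually_le_nhds one_pos).filter_mono nhdsWithin_le_nhds
    have h3 : ∀ᶠ e : ℝ in nhdsWithin 0 (Ioi 0), e ≤ e₀ :=
      (eventually_le_nhds he₀).filter_mono nhdsWithin_le_nhds
    have h2 : ∀ᶠ e : ℝ in nhdsWithin 0 (Ioi 0), (e * R) ^ 2 ≤ 1 / 2 := by
      have hc : ContinuousAt (fun e : ℝ => (e * R) ^ 2) 0 := Continuous.continuousAt (by fun_prop)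
      exact (hc.eventually (eventually_le_nhds (by norm_num))).filter_mono nhdsWithin_le_nhds
    filter_upwards [h1, h2, h3, self_mem_nhdsWithin] with e a1 a2 a3 a4 using ⟨a4, a1, a3, a2⟩
  have hbound : ∀ e, 0 < e → e ≤ 1 → (e * R) ^ 2 ≤ 1 / 2 → ∀ s ∈ Icc 0 T, ∀ t ∈ Icc 0 T,
      ‖D s t * ∫ q, stretchIntegrand e (c s) (d t) q‖ ≤ C := by
    intro e he he1 heR s hs t ht
    rw [norm_mul]
    refine mul_le_mul (hB (s, t) ⟨hs, ht⟩) ?_ (norm_nonneg _)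
      ((norm_nonneg _).trans (hB (s, t) ⟨hs, ht⟩))
    refine integral_stretchIntegrand_le hr0 (hrle s hs t ht) he.le he1 (le_trans ?_ heR)
    exact pow_le_pow_left₀ (by positivity) (mul_le_mul_of_nonneg_left (hR s hs) he.le) 2
  have huIoc : ∀ {s}, s ∈ uIoc (0 : ℝ) T → s ∈ Icc 0 T := by
    intro s hs
    rw [uIoc_of_le hT.le] at hs
    exact Ioc_subset_Icc_self hs
  have hinner : ∀ s ∈ Icc 0 T, Filter.Tendsto (fun e => ∫ t in (0 : ℝ)..T,
      D s t * ∫ q, stretchIntegrand e (c s) (d t) q) (nhdsWithin 0 (Ioi 0))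
      (nhds (∫ t in (0 : ℝ)..T, D s t * (1 / (4 * Real.pi * ‖c s - d t‖ ^ 3)))) := by
    intro s hs
    refine intervalIntegral.tendsto_integral_filter_of_dominated_convergence (fun _ => C) ?_ ?_
      (by simp) (Filter.Eventually.of_forall fun t _ =>
        (tendsto_integral_stretchIntegrand (hne s t)).const_mul _)
    · filter_upwards [hsmall] with e he
      exact ((hKc e he.1).comp (f := fun t : ℝ => (s, t)) (by fun_prop)).aestronglyMeasurable
    · filter_upwards [hsmall] with e he
      exact Filter.Eventually.of_forall fun t ht =>
        hbound e he.1 he.2.1 he.2.2.2 s hs t (huIoc ht)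
  have houter : Filter.Tendsto (fun e => ∫ s in (0 : ℝ)..T, ∫ t in (0 : ℝ)..T,
      D s t * ∫ q, stretchIntegrand e (c s) (d t) q) (nhdsWithin 0 (Ioi 0))
      (nhds (∫ s in (0 : ℝ)..T, ∫ t in (0 : ℝ)..T,
        D s t * (1 / (4 * Real.pi * ‖c s - d t‖ ^ 3)))) := by
    refine intervalIntegral.tendsto_integral_filter_of_dominated_convergence (fun _ => C * T) ?_ ?_
      (by simp) (Filter.Eventually.of_forall fun s hs => hinner s (huIoc hs))
    · filter_upwards [hsmall] with e he
      exact (intervalIntegral.continuous_parametric_intervalIntegral_of_continuous'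
        (hKc e he.1) 0 T).aestronglyMeasurable
    · filter_upwards [hsmall] with e he
      refine Filter.Eventually.of_forall fun s hs => ?_
      have := intervalIntegral.norm_integral_le_of_norm_le_const (a := (0 : ℝ)) (b := T)
        (fun t ht => hbound e he.1 he.2.1 he.2.2.2 s (huIoc hs) t (huIoc ht))
      rwa [sub_zero, abs_of_pos hT] at this
  have hconst : Filter.Tendsto (fun e => ∫ s in (0 : ℝ)..T, ∫ t in (0 : ℝ)..T,
      D s t * ∫ q, stretchIntegrand e (c s) (d t) q) (nhdsWithin 0 (Ioi 0)) (nhds l) := by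
    refine tendsto_const_nhds.congr' ?_
    filter_upwards [hsmall] with e he
    exact (hI e he.1 he.2.2.1).symm
  rw [← tendsto_nhds_unique houter hconst, ← intervalIntegral.integral_const_mul]
  congr 1; funext s
  rw [← intervalIntegral.integral_const_mul]
  congr 1; funext t
  rw [div_mul_div_comm, one_mul, mul_one_div]

/-! ### Homotopies from the self-join to the stereographic images -/

/-- A vanishing combination gives `a x(s) + b x(t) = (a - b) p`. Comparing squared norms yields
`2ab(1 + ⟨x(s), x(t)⟩) ≤ 0`, and the bracket is positive because the points are not antipodal; hence
`a b = 0`. -/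
theorem joinIndep_antipodal {x : ℝ → E4} (hx : ∀ t, ‖x t‖ = 1) (hne : ∀ s t, x s ≠ -x t)
    {p : E4} (hp : ‖p‖ ≤ 1) (hxp : ∀ t, x t ≠ p) (hxp' : ∀ t, x t ≠ -p) :
    JoinIndep (fun s => x s - p) (fun t => x t + p) := by
  intro s t a b ha hb h
  have h1 : a • x s + b • x t = (a - b) • p := by
    rw [← sub_eq_zero, ← h]; module
  have h2 : ‖a • x s + b • x t‖ ^ 2 ≤ (a - b) ^ 2 := by
    rw [h1, norm_smul, mul_pow, Real.norm_eq_abs, sq_abs]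
    exact mul_le_of_le_one_right (sq_nonneg _) (pow_le_one₀ (norm_nonneg _) hp)
  rw [@norm_add_sq ℝ, norm_smul, norm_smul, hx, hx, inner_smul_left, inner_smul_right] at h2
  simp only [RCLike.conj_to_real, Real.norm_eq_abs, mul_one, sq_abs, RCLike.re_to_real] at h2
  have h3 : 0 < 1 + inner ℝ (x s) (x t) := by
    have h4 : ‖x s + x t‖ ^ 2 = 2 * (1 + inner ℝ (x s) (x t)) := by
      rw [@norm_add_sq ℝ, hx, hx]; simp only [RCLike.re_to_real]; ring
    have h5 : 0 < ‖x s + x t‖ := norm_pos_iff.2 fun h0 => hne s t (eq_neg_of_add_eq_zero_left h0)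
    have := pow_pos h5 2
    linarith
  have h4 : a * b = 0 := by
    refine le_antisymm ?_ (mul_nonneg ha hb)
    by_contra h'
    push Not at h'
    have := mul_pos h' h3
    linarith
  rcases mul_eq_zero.1 h4 with rfl | rfl
  · refine ⟨rfl, ?_⟩
    rw [zero_smul, zero_add, smul_eq_zero] at h
    exact h.resolve_right fun h => hxp' t (eq_neg_of_add_eq_zero_left h)
  · refine ⟨?_, rfl⟩
    rw [zero_smul, add_zero, smul_eq_zero] at h
    exact h.resolve_right fun h => hxp s (sub_eq_zero.1 h)

theorem JoinIndep.smul {X Y : ℝ → E4} (h : JoinIndep X Y) {f g : ℝ → ℝ} (hf : ∀ s, 0 < f s)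
    (hg : ∀ t, 0 < g t) : JoinIndep (fun s => f s • X s) (fun t => g t • Y t) := by
  intro s t a b ha hb h0
  have := h s t (a * f s) (b * g t) (mul_nonneg ha (hf s).le) (mul_nonneg hb (hg t).le)
    (by rw [mul_smul, mul_smul]; exact h0)
  exact ⟨(mul_eq_zero.1 this.1).resolve_right (hf s).ne',
    (mul_eq_zero.1 this.2).resolve_right (hg t).ne'⟩

theorem joinIndep_stretch {v : E4} (hv : ‖v‖ = 1) {c d : ℝ → E4} (hvc : ∀ s, inner ℝ v (c s) = 0)
    (hvd : ∀ t, inner ℝ v (d t) = 0) (hne : ∀ s t, c s ≠ d t) {h : ℝ} (hh : 0 < h) :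
    JoinIndep (fun s => c s - h • v) (fun t => h • v - d t) := by
  intro s t a b ha hb h0
  have h1 := congrArg (inner ℝ v) h0
  simp only [inner_add_right, inner_smul_right, inner_sub_right, hvc, hvd,
    real_inner_self_eq_norm_sq, hv, inner_zero_right] at h1
  have hab : a = b := by nlinarith
  subst hab
  have h2 : a • (c s - d t) = 0 := by rw [← h0]; module
  have := (smul_eq_zero.1 h2).resolve_right (sub_ne_zero.2 (hne s t))
  exact ⟨this, this⟩

theorem coe_stereoToFun {v : E4} (hv : ‖v‖ = 1) (x : E4) :
    (stereoToFun v x : E4) = (2 / (1 - inner ℝ v x)) • (x - inner ℝ v x • v) := by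
  rw [stereoToFun_apply, Submodule.coe_smul]
  congr 1
  change (ℝ ∙ v)ᗮ.starProjection x = _
  rw [Submodule.starProjection_orthogonal_val, Submodule.starProjection_unit_singleton ℝ hv]

theorem inner_stereoToFun (v x : E4) : inner ℝ v (stereoToFun v x : E4) = 0 :=
  Submodule.mem_orthogonal_singleton_iff_inner_right.1 (stereoToFun v x).2

theorem inner_lt_one_of_ne {v x : E4} (hv : ‖v‖ = 1) (hx : ‖x‖ = 1) (h : x ≠ v) :
    inner ℝ v x < 1 :=
  inner_lt_one_iff_real_of_norm_eq_one hv hx |>.2 h.symm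

theorem contDiff_stereoToFun_comp {v : E4} (hv : ‖v‖ = 1) {x : ℝ → E4} (hx : ContDiff ℝ 1 x)
    (hn : ∀ t, ‖x t‖ = 1) (hxv : ∀ t, x t ≠ v) :
    ContDiff ℝ 1 fun t => (stereoToFun v (x t) : E4) := by
  simp only [coe_stereoToFun hv]
  have h1 : ContDiff ℝ 1 fun t => inner ℝ v (x t) := contDiff_const.inner ℝ hx
  refine ContDiff.smul (ContDiff.div contDiff_const (contDiff_const.sub h1) fun t => ?_)
    (hx.sub (h1.smul contDiff_const))
  exact (sub_pos.2 (inner_lt_one_of_ne hv (hn t) (hxv t))).ne'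

/-- The linking number of a loop in the three-sphere and its antipode, computed by Gauss's
integral, is the degree of the join of the loop with itself. -/
theorem gauss_integral_antipodal_eq {v : E4} (hv : ‖v‖ = 1) {x : ℝ → E4} (hx : ContDiff ℝ 1 x)
    (hn : ∀ t, ‖x t‖ = 1) {T : ℝ} (hT : 0 < T) (hp : x.Periodic T) (hne : ∀ s t, x s ≠ -x t)
    (hxv : ∀ t, x t ≠ v) (hxv' : ∀ t, x t ≠ -v) :
    1 / (4 * Real.pi) * ∫ s in (0 : ℝ)..T, ∫ t in (0 : ℝ)..T,
      rowDet ![-v, (stereoToFun v (x s) : E4) - stereoToFun v (-x t),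
        deriv (fun s => (stereoToFun v (x s) : E4)) s,
        deriv (fun t => (stereoToFun v (-x t) : E4)) t] /
        ‖(stereoToFun v (x s) : E4) - stereoToFun v (-x t)‖ ^ 3 = joinIntegral x x T := by
  have hn' : ∀ t, ‖-x t‖ = 1 := fun t => by rw [norm_neg, hn]
  have hxv2 : ∀ t, -x t ≠ v := fun t h => hxv' t (by rw [← h, neg_neg])
  set c : ℝ → E4 := fun t => (stereoToFun v (x t) : E4) with hc
  set d : ℝ → E4 := fun t => (stereoToFun v (-x t) : E4) with hd
  have hcC : ContDiff ℝ 1 c := contDiff_stereoToFun_comp hv hx hn hxv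
  have hdC : ContDiff ℝ 1 d := contDiff_stereoToFun_comp hv hx.neg hn' hxv2
  have hcp : c.Periodic T := fun t => by simp only [hc, hp t]
  have hdp : d.Periodic T := fun t => by simp only [hd, hp t]
  set f : ℝ → ℝ := fun t => 2 / (1 - inner ℝ v (x t)) with hf
  set g : ℝ → ℝ := fun t => 2 / (1 - inner ℝ v (-x t)) with hg
  have hf1 : ∀ t, 0 < 1 - inner ℝ v (x t) := fun t =>
    sub_pos.2 (inner_lt_one_of_ne hv (hn t) (hxv t))
  have hg1 : ∀ t, 0 < 1 - inner ℝ v (-x t) := fun t =>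
    sub_pos.2 (inner_lt_one_of_ne hv (hn' t) (hxv2 t))
  have hf0 : ∀ t, 0 < f t := fun t => div_pos two_pos (hf1 t)
  have hg0 : ∀ t, 0 < g t := fun t => div_pos two_pos (hg1 t)
  -- Stereographic projection, here doubled to scale, keeps points on the ray from the pole: `c -
  -- 2v` is a positive multiple of `x - v`. Likewise `2v - d` is one of `x + v`.
  have hcf : (fun t => c t - (2 : ℝ) • v) = fun t => f t • (x t - v) := by
    funext t
    have : f t * (1 - inner ℝ v (x t)) = 2 := div_mul_cancel₀ _ (hf1 t).ne'
    have hct : c t = f t • (x t - inner ℝ v (x t) • v) := coe_stereoToFun hv (x t)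
    change c t - (2 : ℝ) • v = f t • (x t - v)
    rw [← this, hct]
    module
  have hdg : (fun t => (2 : ℝ) • v - d t) = fun t => g t • (x t + v) := by
    funext t
    have : g t * (1 - inner ℝ v (-x t)) = 2 := div_mul_cancel₀ _ (hg1 t).ne'
    have hdt : d t = g t • (-x t - inner ℝ v (-x t) • v) := coe_stereoToFun hv (-x t)
    change (2 : ℝ) • v - d t = g t • (x t + v)
    rw [← this, hdt]
    module
  have hJ1 : ∀ r ∈ Icc (0 : ℝ) 1, JoinIndep (fun s => x s - r • v) (fun t => x t + r • v) := by
    intro r hr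
    have hrv : ‖r • v‖ = r := by rw [norm_smul, hv, mul_one, Real.norm_of_nonneg hr.1]
    refine joinIndep_antipodal hn hne (by rw [hrv]; exact hr.2) (fun t h => ?_) (fun t h => ?_)
    · have h1 : r = 1 := by rw [← hrv, ← h, hn]
      rw [h1, one_smul] at h; exact hxv t h
    · have h1 : r = 1 := by rw [← hrv, ← norm_neg, ← h, hn]
      rw [h1, one_smul] at h; exact hxv' t h
  have hJv : JoinIndep (fun s => x s - v) (fun t => x t + v) := by
    simpa using hJ1 1 (right_mem_Icc.2 zero_le_one)
  have hJ2 : JoinIndep (fun t => c t - (2 : ℝ) • v) (fun t => (2 : ℝ) • v - d t) := by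
    rw [hcf, hdg]; exact hJv.smul hf0 hg0
  have hcd : ∀ s t, c s ≠ d t := by
    intro s t h
    have := hJ2 s t 1 1 zero_le_one zero_le_one (by simp only [h]; module)
    exact one_ne_zero this.1
  have hvc : ∀ t, inner ℝ v (c t) = 0 := fun t => inner_stereoToFun v _
  have hvd : ∀ t, inner ℝ v (d t) = 0 := fun t => inner_stereoToFun v _
  have hxp1 : (fun t => x t - v).Periodic T := fun t => by simp only [hp t]
  have hxp2 : (fun t => x t + v).Periodic T := fun t => by simp only [hp t]
  have hcp' : ∀ h : ℝ, (fun t => c t - h • v).Periodic T := fun h t => by simp only [hcp t]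
  have hdp' : ∀ h : ℝ, (fun t => h • v - d t).Periodic T := fun h t => by simp only [hdp t]
  -- Three homotopies follow: translating the curves by `∓ r v`, rescaling along rays, and changing
  -- the height from `2` to `h`.
  have e1 : joinIntegral x x T = joinIntegral (fun t => x t - v) (fun t => x t + v) T := by
    refine joinIntegral_eq_of_lineHomotopy hT hx (by fun_prop) hx (by fun_prop) hp hxp1 hp hxp2
      fun r hr => ?_
    have h1 : lineHomotopy x (fun t => x t - v) r = fun s => x s - r • v := by
      funext s; simp only [lineHomotopy]; module
    have h2 : lineHomotopy x (fun t => x t + v) r = fun s => x s + r • v := by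
      funext s; simp only [lineHomotopy]; module
    rw [h1, h2]; exact hJ1 r hr
  have e2 : joinIntegral (fun t => x t - v) (fun t => x t + v) T =
      joinIntegral (fun t => c t - (2 : ℝ) • v) (fun t => (2 : ℝ) • v - d t) T := by
    refine joinIntegral_eq_of_lineHomotopy hT (by fun_prop) (by fun_prop) (by fun_prop)
      (by fun_prop) hxp1 (hcp' 2) hxp2 (hdp' 2) fun r hr => ?_
    have hpos : ∀ {u : ℝ}, 0 < u → 0 < (1 - r) + r * u := by
      intro u hu
      rcases hr.1.eq_or_lt with h | h
      · rw [← h]; norm_num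
      · have := mul_pos h hu
        linarith [hr.2]
    rw [hcf, hdg]
    have h1 : lineHomotopy (fun t => x t - v) (fun t => f t • (x t - v)) r =
        fun s => ((1 - r) + r * f s) • (x s - v) := by
      funext s; simp only [lineHomotopy]; module
    have h2 : lineHomotopy (fun t => x t + v) (fun t => g t • (x t + v)) r =
        fun s => ((1 - r) + r * g s) • (x s + v) := by
      funext s; simp only [lineHomotopy]; module
    rw [h1, h2]
    exact hJv.smul (fun s => hpos (hf0 s)) (fun s => hpos (hg0 s))
  have e3 : ∀ h : ℝ, 0 < h → joinIntegral (fun t => c t - (2 : ℝ) • v) (fun t => (2 : ℝ) • v - d t) T =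
      joinIntegral (fun t => c t - h • v) (fun t => h • v - d t) T := by
    intro h hh
    refine joinIntegral_eq_of_lineHomotopy hT (by fun_prop) (by fun_prop) (by fun_prop)
      (by fun_prop) (hcp' 2) (hcp' h) (hdp' 2) (hdp' h) fun r hr => ?_
    have h1 : lineHomotopy (fun t => c t - (2 : ℝ) • v) (fun t => c t - h • v) r =
        fun s => c s - ((1 - r) * 2 + r * h) • v := by
      funext s; simp only [lineHomotopy]; module
    have h2 : lineHomotopy (fun t => (2 : ℝ) • v - d t) (fun t => h • v - d t) r =
        fun s => ((1 - r) * 2 + r * h) • v - d s := by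
      funext s; simp only [lineHomotopy]; module
    rw [h1, h2]
    refine joinIndep_stretch hv hvc hvd hcd ?_
    rcases hr.1.eq_or_lt with h | h
    · rw [← h]; norm_num
    · have := mul_pos h hh
      linarith [hr.2]
  exact gauss_integral_eq_of_stretch hv hcC hdC hvc hvd hT hcd one_pos
    (fun e he => joinIndep_stretch hv hvc hvd hcd (inv_pos.2 he))
    (fun e he _ => by rw [e1, e2, e3 _ (inv_pos.2 he)])

/-! ### The projection to projective space is a local diffeomorphism -/

instance : Fact (Module.finrank ℝ E4 = 3 + 1) := ⟨by simp⟩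

/-- A chart of `RP3` is a sphere chart after a local inverse, and a local inverse composed with the
projection is locally the identity or the antipodal map. -/
theorem contMDiff_projRP3 : ContMDiff (𝓡 3) (𝓡 3) ω projRP3 := by
  intro x
  rw [contMDiffAt_iff_target]
  refine ⟨continuous_projRP3.continuousAt, ?_⟩
  set x' := projRP3_surjective.hasRightInverse.choose (projRP3 x) with hx'
  have hx2 : projRP3 x' = projRP3 x := projRP3_surjective.hasRightInverse.choose_spec (projRP3 x)
  have hmem : projRP3 x ∈ (isLocalHomeomorph_projRP3.localInverseAt x').source := by
    rw [← hx2]; exact isLocalHomeomorph_projRP3.apply_self_mem_localInverseAt_source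
  have h2 := contMDiffAt_localInverse_comp_projRP3 x' x hmem
  have h3 : ContMDiffAt (𝓡 3) 𝓘(ℝ, EuclideanSpace ℝ (Fin 3)) ω
      (chartAt (EuclideanSpace ℝ (Fin 3)) x')
      (isLocalHomeomorph_projRP3.localInverseAt x' (projRP3 x)) := by
    rw [← hx2, isLocalHomeomorph_projRP3.localInverseAt_apply_self]
    exact (contMDiffOn_chart (I := 𝓡 3) (n := ω) (x := x')).contMDiffAt
      ((chartAt (EuclideanSpace ℝ (Fin 3)) x').open_source.mem_nhds (mem_chart_source _ x'))
  exact ContMDiffAt.comp (g := chartAt (EuclideanSpace ℝ (Fin 3)) x')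
    (f := fun w => isLocalHomeomorph_projRP3.localInverseAt x' (projRP3 w)) x h3 h2

theorem contMDiffAt_localInverse (x : S3) {q : RP3}
    (hq : q ∈ (isLocalHomeomorph_projRP3.localInverseAt x).source) :
    ContMDiffAt (𝓡 3) (𝓡 3) ω (isLocalHomeomorph_projRP3.localInverseAt x) q := by
  rw [contMDiffAt_iff_source]
  set x' := projRP3_surjective.hasRightInverse.choose q with hx'
  have hx2 : projRP3 x' = q := projRP3_surjective.hasRightInverse.choose_spec q
  have hx3 : isLocalHomeomorph_projRP3.localInverseAt x' q = x' := by
    rw [← hx2]; exact isLocalHomeomorph_projRP3.localInverseAt_apply_self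
  set c := chartAt (EuclideanSpace ℝ (Fin 3)) x' with hc
  have e1 : extChartAt (𝓡 3) q q = c x' := by
    change c (isLocalHomeomorph_projRP3.localInverseAt x' q) = c x'
    rw [hx3]
  have e2 : ((extChartAt (𝓡 3) q).symm : EuclideanSpace ℝ (Fin 3) → RP3) =
      fun u => projRP3 (c.symm u) := by
    funext u
    change (isLocalHomeomorph_projRP3.localInverseAt x').symm (c.symm u) = _
    rw [isLocalHomeomorph_projRP3.localInverseAt_symm]
  rw [e1, e2]
  refine ContMDiffAt.contMDiffWithinAt ?_
  have hcs : c.symm (c x') = x' := c.left_inv (mem_chart_source _ x')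
  have h1 : ContMDiffAt (𝓡 3) (𝓡 3) ω c.symm (c x') :=
    (contMDiffOn_chart_symm (I := 𝓡 3)).contMDiffAt
      (c.open_target.mem_nhds (c.map_source (mem_chart_source _ x')))
  have h2 : ContMDiffAt (𝓡 3) (𝓡 3) ω
      (fun w => isLocalHomeomorph_projRP3.localInverseAt x (projRP3 w)) (c.symm (c x')) := by
    rw [hcs]
    exact contMDiffAt_localInverse_comp_projRP3 x x' (by rw [hx2]; exact hq)
  exact ContMDiffAt.comp (f := c.symm) (c x') h2 h1

theorem mfderiv_localInverse (x : S3) :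
    (mfderiv (𝓡 3) (𝓡 3) projRP3 x) ∘L
      (mfderiv (𝓡 3) (𝓡 3) (isLocalHomeomorph_projRP3.localInverseAt x) (projRP3 x)) =
        ContinuousLinearMap.id ℝ (TangentSpace (𝓡 3) (projRP3 x)) ∧
    (mfderiv (𝓡 3) (𝓡 3) (isLocalHomeomorph_projRP3.localInverseAt x) (projRP3 x)) ∘L
      (mfderiv (𝓡 3) (𝓡 3) projRP3 x) = ContinuousLinearMap.id ℝ (TangentSpace (𝓡 3) x) := by
  set h := isLocalHomeomorph_projRP3.localInverseAt x with hh
  have hx : h (projRP3 x) = x := isLocalHomeomorph_projRP3.localInverseAt_apply_self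
  have hsrc : projRP3 x ∈ h.source := isLocalHomeomorph_projRP3.apply_self_mem_localInverseAt_source
  have htgt : x ∈ h.target := isLocalHomeomorph_projRP3.self_mem_localInverseAt_target
  have hp : HasMFDerivAt (𝓡 3) (𝓡 3) projRP3 x (mfderiv (𝓡 3) (𝓡 3) projRP3 x) :=
    (contMDiff_projRP3.mdifferentiable (by simp) x).hasMFDerivAt
  have hi : HasMFDerivAt (𝓡 3) (𝓡 3) h (projRP3 x) (mfderiv (𝓡 3) (𝓡 3) h (projRP3 x)) :=
    ((contMDiffAt_localInverse x hsrc).mdifferentiableAt (by simp)).hasMFDerivAt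
  constructor
  · have h1 : HasMFDerivAt (𝓡 3) (𝓡 3) (projRP3 ∘ h) (projRP3 x) _ :=
      HasMFDerivAt.comp (projRP3 x) (g := projRP3) (g' := mfderiv (𝓡 3) (𝓡 3) projRP3 x)
        (by rw [hx]; exact hp) hi
    have h2 : HasMFDerivAt (𝓡 3) (𝓡 3) (projRP3 ∘ h) (projRP3 x)
        (ContinuousLinearMap.id ℝ (TangentSpace (𝓡 3) (projRP3 x))) := by
      refine (hasMFDerivAt_id (projRP3 x)).congr_of_eventuallyEq ?_
      filter_upwards [h.open_source.mem_nhds hsrc] with q hq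
      exact isLocalHomeomorph_projRP3.apply_localInverseAt_of_mem hq
    exact hasMFDerivAt_unique h1 h2
  · have h1 := HasMFDerivAt.comp x hi hp
    have h2 : HasMFDerivAt (𝓡 3) (𝓡 3) (h ∘ projRP3) x
        (ContinuousLinearMap.id ℝ (TangentSpace (𝓡 3) x)) := by
      refine (hasMFDerivAt_id x).congr_of_eventuallyEq ?_
      filter_upwards [h.open_target.mem_nhds htgt] with y hy
      have := h.right_inv hy
      rw [hh, isLocalHomeomorph_projRP3.localInverseAt_symm] at this
      exact this
    exact hasMFDerivAt_unique h1 h2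

/-- Guarantees that the pullback in `liftVF` uses a true inverse, not the default value for
non-invertible maps. -/
theorem isInvertible_mfderiv_projRP3 (x : S3) :
    (mfderiv (𝓡 3) (𝓡 3) projRP3 x).IsInvertible :=
  ContinuousLinearMap.IsInvertible.of_inverse (mfderiv_localInverse x).1 (mfderiv_localInverse x).2

theorem liftVF_apply_eq (Z : (x : RP3) → TangentSpace (𝓡 3) x) (x : S3) :
    liftVF Z x = mfderiv (𝓡 3) (𝓡 3) (isLocalHomeomorph_projRP3.localInverseAt x) (projRP3 x)
      (Z (projRP3 x)) := by
  refine (isInvertible_mfderiv_projRP3 x).inverse_apply_eq.2 ?_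
  exact (congrArg (fun L => L (Z (projRP3 x))) (mfderiv_localInverse x).1).symm

theorem mfderiv_projRP3_liftVF (Z : (x : RP3) → TangentSpace (𝓡 3) x) (x : S3) :
    mfderiv (𝓡 3) (𝓡 3) projRP3 x (liftVF Z x) = Z (projRP3 x) := by
  rw [liftVF_apply_eq]
  exact congrArg (fun L => L (Z (projRP3 x))) (mfderiv_localInverse x).1

theorem isSmoothVectorField_liftVF {Z : (x : RP3) → TangentSpace (𝓡 3) x}
    (hZ : IsSmoothVectorField Z) : IsSmoothVectorField (liftVF Z) :=
  ContMDiff.mpullback_vectorField hZ (contMDiff_projRP3.of_le le_top) isInvertible_mfderiv_projRP3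
    (n := ω) le_top

theorem isMIntegralCurve_projRP3_comp {Z : (x : RP3) → TangentSpace (𝓡 3) x} {γ : ℝ → S3}
    (hγ : IsMIntegralCurve γ (liftVF Z)) : IsMIntegralCurve (fun t => projRP3 (γ t)) Z := by
  intro t
  have hp : HasMFDerivAt (𝓡 3) (𝓡 3) projRP3 (γ t) (mfderiv (𝓡 3) (𝓡 3) projRP3 (γ t)) :=
    (contMDiff_projRP3.mdifferentiable (by simp) (γ t)).hasMFDerivAt
  refine (HasMFDerivAt.comp t hp (hγ t)).congr_mfderiv (ContinuousLinearMap.ext_ring ?_)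
  change mfderiv (𝓡 3) (𝓡 3) projRP3 (γ t) ((1 : ℝ) • liftVF Z (γ t)) =
    (1 : ℝ) • Z (projRP3 (γ t))
  rw [one_smul, one_smul, mfderiv_projRP3_liftVF]

/-- By continuity, `γ` is locally its projection followed by one local inverse, so the chain rule
applies. -/
theorem isMIntegralCurve_lift {Z : (x : RP3) → TangentSpace (𝓡 3) x} {γ : ℝ → S3}
    (hc : Continuous γ) (h : IsMIntegralCurve (fun t => projRP3 (γ t)) Z) :
    IsMIntegralCurve γ (liftVF Z) := by
  intro t
  set e := isLocalHomeomorph_projRP3.localInverseAt (γ t) with he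
  have hi : HasMFDerivAt (𝓡 3) (𝓡 3) e (projRP3 (γ t)) (mfderiv (𝓡 3) (𝓡 3) e (projRP3 (γ t))) :=
    ((contMDiffAt_localInverse (γ t)
      isLocalHomeomorph_projRP3.apply_self_mem_localInverseAt_source).mdifferentiableAt
        (by simp)).hasMFDerivAt
  have h1 := HasMFDerivAt.comp (f := fun t => projRP3 (γ t)) t hi (h t)
  have h2 : γ =ᶠ[nhds t] e ∘ fun t => projRP3 (γ t) := by
    filter_upwards [hc.continuousAt.preimage_mem_nhds (e.open_target.mem_nhds
      isLocalHomeomorph_projRP3.self_mem_localInverseAt_target)] with s hs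
    have := e.right_inv hs
    rw [he, isLocalHomeomorph_projRP3.localInverseAt_symm] at this
    exact this.symm
  refine (h1.congr_of_eventuallyEq h2).congr_mfderiv (ContinuousLinearMap.ext_ring ?_)
  change mfderiv (𝓡 3) (𝓡 3) e (projRP3 (γ t)) ((1 : ℝ) • Z (projRP3 (γ t))) =
    (1 : ℝ) • liftVF Z (γ t)
  rw [one_smul, one_smul, liftVF_apply_eq]

/-- The velocity is the tangent map of the inclusion applied to `W` along the curve, hence
continuous. -/
theorem IsMIntegralCurve.contDiff_coe {W : (x : S3) → TangentSpace (𝓡 3) x}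
    (hW : IsSmoothVectorField W) {γ : ℝ → S3} (hγ : IsMIntegralCurve γ W) :
    ContDiff ℝ 1 fun t => (γ t : E4) := by
  have hcoe : ContMDiff (𝓡 3) 𝓘(ℝ, E4) 1 ((↑) : S3 → E4) := contMDiff_coe_sphere
  have hγc : Continuous γ := continuous_iff_continuousAt.2 fun t => (hγ t).1
  set D : ℝ → E4 := fun t => mfderiv (𝓡 3) 𝓘(ℝ, E4) ((↑) : S3 → E4) (γ t) (W (γ t)) with hD
  have hder : ∀ t, HasDerivAt (fun t => (γ t : E4)) (D t) t := by
    intro t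
    have h1 := HasMFDerivAt.comp t
      ((hcoe.mdifferentiable one_ne_zero (γ t)).hasMFDerivAt) (hγ t)
    have h2 : HasMFDerivAt 𝓘(ℝ, ℝ) 𝓘(ℝ, E4) (fun t => (γ t : E4)) t
        ((1 : ℝ →L[ℝ] ℝ).smulRight (D t)) := by
      refine h1.congr_mfderiv (ContinuousLinearMap.ext_ring ?_)
      change mfderiv (𝓡 3) 𝓘(ℝ, E4) ((↑) : S3 → E4) (γ t) ((1 : ℝ) • W (γ t)) = (1 : ℝ) • D t
      rw [one_smul, one_smul]
    have h3 : HasFDerivAt (fun t => (γ t : E4)) ((1 : ℝ →L[ℝ] ℝ).smulRight (D t)) t :=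
      hasMFDerivAt_iff_hasFDerivAt.1 h2
    simpa using h3.hasDerivAt
  have hDc : Continuous D := by
    have h1 : Continuous fun t => (⟨γ t, W (γ t)⟩ : TangentBundle (𝓡 3) S3) :=
      hW.continuous.comp hγc
    have h2 := (hcoe.continuous_tangentMap le_rfl).comp h1
    have h3 := (tangentBundleModelSpaceHomeomorph 𝓘(ℝ, E4)).continuous.comp h2
    exact continuous_snd.comp h3
  rw [contDiff_one_iff_deriv]
  refine ⟨fun t => (hder t).differentiableAt, ?_⟩
  rw [show deriv (fun t => (γ t : E4)) = D from funext fun t => (hder t).deriv]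
  exact hDc

/-- A `C¹` curve on the three-sphere and its antipode miss a point. -/
theorem exists_notMem_range_union_range_neg {γ : ℝ → S3}
    (hγ : ContDiff ℝ 1 fun t => (γ t : E4)) :
    ∃ v : S3, v ∉ range γ ∪ range fun t => -γ t := by
  have hF : ContDiff ℝ 1 fun p : ℝ × ℝ => p.1 • (γ p.2 : E4) :=
    contDiff_fst.smul (hγ.comp contDiff_snd)
  -- The cone over the curve is a `C¹` image of the plane, so its complement is dense in four-space.
  -- Negative scalars include the antipodal curve.
  have hd := hF.dense_compl_range_of_finrank_lt_finrank (by simp)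
  obtain ⟨w, hw⟩ := hd.nonempty
  have hw0 : w ≠ 0 := fun h => hw ⟨(0, 0), by simp [h]⟩
  have hn : ‖w‖ ≠ 0 := norm_ne_zero_iff.2 hw0
  refine ⟨⟨‖w‖⁻¹ • w, by simp [norm_smul, hn]⟩, ?_⟩
  rintro (⟨t, ht⟩ | ⟨t, ht⟩)
  · refine hw ⟨(‖w‖, t), ?_⟩
    have : (γ t : E4) = ‖w‖⁻¹ • w := congrArg Subtype.val ht
    simp only [this, smul_smul, mul_inv_cancel₀ hn, one_smul]
  · refine hw ⟨(-‖w‖, t), ?_⟩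
    have : -(γ t : E4) = ‖w‖⁻¹ • w := congrArg Subtype.val ht
    simp only [neg_smul, ← smul_neg, this, smul_smul, mul_inv_cancel₀ hn, one_smul]

/-- Contract to `-v` along normalised segments. A segment from `f a` to `-v` meets the origin only
if `f a = v`. -/
theorem nullhomotopic_of_notMem_range {A : Type*} [TopologicalSpace A] (f : C(A, S3)) {v : S3}
    (hv : v ∉ range f) : f.Nullhomotopic := by
  have hne : ∀ (r : unitInterval) (a : A), (1 - (r : ℝ)) • (f a : E4) - (r : ℝ) • (v : E4) ≠ 0 := by
    intro r a h
    have h1 := sub_eq_zero.1 h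
    have h2 := congrArg norm h1
    rw [norm_smul, norm_smul, Real.norm_of_nonneg (sub_nonneg.2 r.2.2),
      Real.norm_of_nonneg r.2.1] at h2
    simp only [norm_eq_of_mem_sphere, mul_one] at h2
    have h3 : (r : ℝ) = 1 / 2 := by linarith
    rw [h3] at h1
    norm_num at h1
    exact hv ⟨a, Subtype.ext h1⟩
  set u : unitInterval × A → E4 :=
    fun p => (1 - (p.1 : ℝ)) • (f p.2 : E4) - (p.1 : ℝ) • (v : E4) with hu
  have hu0 : ∀ p, u p ≠ 0 := fun p => hne p.1 p.2
  have huc : Continuous u := by fun_prop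
  have hmem : ∀ p, ‖u p‖⁻¹ • u p ∈ sphere (0 : E4) 1 := fun p => by
    rw [mem_sphere_zero_iff_norm, norm_smul, norm_inv, norm_norm,
      inv_mul_cancel₀ (norm_ne_zero_iff.2 (hu0 p))]
  let G : C(unitInterval × A, S3) := ⟨fun p => ⟨‖u p‖⁻¹ • u p, hmem p⟩,
    ((huc.norm.inv₀ fun p => norm_ne_zero_iff.2 (hu0 p)).smul huc).subtype_mk hmem⟩
  have hG0 : ∀ a, G (0, a) = f a := fun a => by
    have h1 : u (0, a) = f a := by
      simp only [hu, Set.Icc.coe_zero, sub_zero, one_smul, zero_smul]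
    refine Subtype.ext ?_
    change ‖u (0, a)‖⁻¹ • u (0, a) = _
    rw [h1, norm_eq_of_mem_sphere, inv_one, one_smul]
  have hG1 : ∀ a, G (1, a) = -v := fun a => by
    have h1 : u (1, a) = -(v : E4) := by
      simp only [hu, Set.Icc.coe_one, sub_self, one_smul, zero_smul, zero_sub]
    refine Subtype.ext ?_
    change ‖u (1, a)‖⁻¹ • u (1, a) = -(v : E4)
    rw [h1, norm_neg, norm_eq_of_mem_sphere, inv_one, one_smul]
  exact ⟨-v, ⟨⟨G, hG0, hG1⟩⟩⟩

instance : T2Space RP3 := by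
  have hq : IsOpenQuotientMap projRP3 :=
    ⟨projRP3_surjective, continuous_projRP3, isOpenMap_projRP3⟩
  rw [t2Space_iff_of_isOpenQuotientMap hq]
  have : {q : S3 × S3 | projRP3 q.1 = projRP3 q.2} = {q | q.1 = q.2} ∪ {q | q.1 = -q.2} := by
    ext q; exact projRP3_eq_iff
  rw [this]
  exact (isClosed_eq continuous_fst continuous_snd).union
    (isClosed_eq continuous_fst continuous_snd.neg)

/-- The sphere is compact and both spaces are Hausdorff, so a local homeomorphism is a covering. -/
theorem isCoveringMap_projRP3 : IsCoveringMap projRP3 :=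
  isLocalHomeomorph_iff_isCoveringMap.1 isLocalHomeomorph_projRP3

/-! ### Orbits and their lifts -/

theorem S3_ne_neg (x : S3) : x ≠ -x := fun h => by
  have := S3_dist_neg x
  rw [← h, dist_self] at this
  norm_num at this

theorem projRP3_neg (x : S3) : projRP3 (-x) = projRP3 x := projRP3_eq_iff.2 (Or.inr rfl)

theorem IsMIntegralCurve.continuous' {M : Type*} [TopologicalSpace M]
    [ChartedSpace (EuclideanSpace ℝ (Fin 3)) M] {Z : (x : M) → TangentSpace (𝓡 3) x} {γ : ℝ → M}
    (h : IsMIntegralCurve γ Z) : Continuous γ :=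
  continuous_iff_continuousAt.2 fun t => (h t).1

theorem IsPrimePeriodic.periodic {M : Type*} [TopologicalSpace M]
    [ChartedSpace (EuclideanSpace ℝ (Fin 3)) M] {Z : (x : M) → TangentSpace (𝓡 3) x} {γ : ℝ → M}
    {T : ℝ} (h : IsPrimePeriodic Z γ T) : γ.Periodic T :=
  fun t => (h.eq_iff _ _).2 ⟨1, by simp⟩

theorem orbitOf_eq_of_mem {X : Type*} {γ η : ℝ → X} (h : η ∈ orbitOf γ) :
    orbitOf η = orbitOf γ := by
  obtain ⟨a, ha⟩ := h
  ext ξ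
  constructor
  · rintro ⟨b, hb⟩
    exact ⟨b + a, fun t => by rw [hb, ha, add_assoc]⟩
  · rintro ⟨b, hb⟩
    exact ⟨b - a, fun t => by rw [hb, ha]; congr 1; ring⟩

theorem mem_orbitOf_self {X : Type*} (γ : ℝ → X) : γ ∈ orbitOf γ := ⟨0, fun t => by rw [add_zero]⟩

theorem image_comp_orbitOf {X Y : Type*} (f : X → Y) (γ : ℝ → X) :
    (fun (η : ℝ → X) t => f (η t)) '' orbitOf γ = orbitOf fun t => f (γ t) := by
  ext ξ
  constructor
  · rintro ⟨η, ⟨a, ha⟩, rfl⟩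
    exact ⟨a, fun t => by simp only [ha]⟩
  · rintro ⟨a, ha⟩
    exact ⟨fun t => γ (t + a), ⟨a, fun t => rfl⟩, funext fun t => (ha t).symm⟩

theorem antipodalOrbit_orbitOf (γ : ℝ → S3) :
    antipodalOrbit (orbitOf γ) = orbitOf fun t => -γ t := image_comp_orbitOf (fun x => -x) γ

theorem projOrbit_orbitOf (γ : ℝ → S3) :
    projOrbit (orbitOf γ) = orbitOf fun t => projRP3 (γ t) := image_comp_orbitOf projRP3 γ

theorem orbitSupport_orbitOf {X : Type*} (γ : ℝ → X) : orbitSupport (orbitOf γ) = range γ := by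
  ext x
  constructor
  · rintro ⟨η, ⟨a, ha⟩, t, rfl⟩
    exact ⟨t + a, (ha t).symm⟩
  · rintro ⟨t, rfl⟩
    exact ⟨γ, mem_orbitOf_self γ, t, rfl⟩

variable {Z : (x : RP3) → TangentSpace (𝓡 3) x}

theorem IsPrimePeriodic.neg {γ : ℝ → S3} {T : ℝ} (h : IsPrimePeriodic (liftVF Z) γ T) :
    IsPrimePeriodic (liftVF Z) (fun t => -γ t) T where
  period_pos := h.period_pos
  isMIntegralCurve := isMIntegralCurve_lift h.isMIntegralCurve.continuous'.neg (by
    simp only [projRP3_neg]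
    exact isMIntegralCurve_projRP3_comp h.isMIntegralCurve)
  eq_iff s t := by rw [neg_inj]; exact h.eq_iff s t

/-- The projection of a periodic orbit that is disjoint from its antipode is prime periodic. -/
theorem IsPrimePeriodic.proj {γ : ℝ → S3} {T : ℝ} (h : IsPrimePeriodic (liftVF Z) γ T)
    (hd : Disjoint (range γ) (range fun t => -γ t)) :
    IsPrimePeriodic Z (fun t => projRP3 (γ t)) T where
  period_pos := h.period_pos
  isMIntegralCurve := isMIntegralCurve_projRP3_comp h.isMIntegralCurve
  eq_iff s t := by
    rw [← h.eq_iff, projRP3_eq_iff, or_iff_left]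
    intro hst
    exact Set.disjoint_left.1 hd ⟨s, rfl⟩ ⟨t, hst.symm⟩

theorem isContractibleLoop_proj (hZ : IsSmoothVectorField Z) {γ : ℝ → S3} {T : ℝ}
    (h : IsPrimePeriodic (liftVF Z) γ T) : IsContractibleLoop (fun t => projRP3 (γ t)) T := by
  have hc : Continuous (h.periodic.lift : AddCircle T → S3) :=
    (QuotientAddGroup.isQuotientMap_mk _).continuous_iff.2 h.isMIntegralCurve.continuous'
  set f : C(AddCircle T, S3) := ⟨h.periodic.lift, hc⟩ with hf
  have hft : ∀ t : ℝ, f (t : AddCircle T) = γ t := fun t => h.periodic.lift_coe t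
  obtain ⟨v, hv⟩ := exists_notMem_range_union_range_neg
    (h.isMIntegralCurve.contDiff_coe (isSmoothVectorField_liftVF hZ))
  have hnull : f.Nullhomotopic := nullhomotopic_of_notMem_range f (v := v) (by
    rintro ⟨a, ha⟩
    obtain ⟨t, rfl⟩ := QuotientAddGroup.mk_surjective a
    exact hv (Or.inl ⟨t, (hft t).symm.trans ha⟩))
  exact ⟨(⟨projRP3, continuous_projRP3⟩ : C(S3, RP3)).comp f,
    fun t => congrArg projRP3 (hft t), hnull.comp_right _⟩

/-- A contractible prime periodic orbit of `Z` lifts to a periodic orbit that is disjoint from its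
antipode. -/
theorem IsPrimePeriodic.exists_lift {ζ : ℝ → RP3} {T : ℝ} (h : IsPrimePeriodic Z ζ T)
    (hc : IsContractibleLoop ζ T) :
    ∃ γ : ℝ → S3, IsPrimePeriodic (liftVF Z) γ T ∧ (∀ t, projRP3 (γ t) = ζ t) ∧
      Disjoint (range γ) (range fun t => -γ t) := by
  obtain ⟨f, hf, y, ⟨H⟩⟩ := hc
  obtain ⟨x, rfl⟩ := projRP3_surjective y
  have H0 : ∀ a, H.symm (0, a) = projRP3 (ContinuousMap.const (AddCircle T) x a) := fun a => by
    rw [H.symm.apply_zero]; rfl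
  -- The null-homotopy is reversed so that its initial map is constant and lifts trivially. The lift
  -- is defined on the circle itself, so its end is `T`-periodic.
  set G := isCoveringMap_projRP3.liftHomotopy H.symm.toContinuousMap (ContinuousMap.const _ x) H0
    with hG
  set γ : ℝ → S3 := fun t => G (1, (t : AddCircle T)) with hγ
  have hγc : Continuous γ :=
    G.continuous.comp (continuous_const.prodMk (AddCircle.continuous_mk' T))
  have hp : ∀ t, projRP3 (γ t) = ζ t := fun t => by
    have h1 := congrFun (isCoveringMap_projRP3.liftHomotopy_lifts H.symm.toContinuousMap
      (ContinuousMap.const _ x) H0) (1, (t : AddCircle T))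
    refine h1.trans ?_
    rw [← hf]
    exact H.symm.apply_one _
  have heq : ∀ s t : ℝ, γ s = γ t ↔ ∃ n : ℤ, s = t + n * T := by
    intro s t
    rw [← h.eq_iff]
    constructor
    · intro hst; rw [← hp, ← hp, hst]
    · intro hst
      obtain ⟨n, rfl⟩ := (h.eq_iff s t).1 hst
      simp only [hγ]
      congr 2
      rw [AddCircle.coe_add, ← zsmul_eq_mul, AddCircle.coe_zsmul, AddCircle.coe_period,
        smul_zero, add_zero]
  refine ⟨γ, ⟨h.period_pos, isMIntegralCurve_lift hγc ?_, heq⟩, hp, ?_⟩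
  · rw [show (fun t => projRP3 (γ t)) = ζ from funext hp]
    exact h.isMIntegralCurve
  · rw [Set.disjoint_left]
    rintro _ ⟨s, rfl⟩ ⟨t, ht⟩
    have h1 : ζ s = ζ t := by rw [← hp, ← hp, ← ht, projRP3_neg]
    have h2 : γ s = γ t := (heq s t).2 ((h.eq_iff s t).1 h1)
    exact S3_ne_neg (γ t) (h2.symm.trans ht.symm)

/-- After a time shift, another lift agrees with `γ` or `-γ` at time zero, and then everywhere by
uniqueness of lifts. -/
theorem IsPrimePeriodic.liftsOfOrbit_eq {γ : ℝ → S3} {T : ℝ}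
    (h : IsPrimePeriodic (liftVF Z) γ T) :
    liftsOfOrbit Z (orbitOf fun t => projRP3 (γ t)) =
      {orbitOf γ, antipodalOrbit (orbitOf γ)} := by
  have hγc := h.isMIntegralCurve.continuous'
  rw [antipodalOrbit_orbitOf]
  ext O
  constructor
  · rintro ⟨⟨η, T', hη, rfl⟩, hO⟩
    rw [projOrbit_orbitOf] at hO
    obtain ⟨a, ha⟩ : (fun t => projRP3 (η t)) ∈ orbitOf fun t => projRP3 (γ t) :=
      hO ▸ mem_orbitOf_self _
    have hηc := hη.isMIntegralCurve.continuous'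
    have hγa : Continuous fun t => γ (t + a) := hγc.comp (continuous_add_const a)
    rcases projRP3_eq_iff.1 (ha 0) with h0 | h0
    · left
      have := isCoveringMap_projRP3.eq_of_comp_eq hηc hγa (funext ha) 0 h0
      exact orbitOf_eq_of_mem ⟨a, fun t => congrFun this t⟩
    · right
      have := isCoveringMap_projRP3.eq_of_comp_eq hηc hγa.neg
        (funext fun t => (ha t).trans (projRP3_neg _).symm) 0 h0
      exact orbitOf_eq_of_mem ⟨a, fun t => congrFun this t⟩
  · rintro (rfl | rfl)
    · exact ⟨⟨γ, T, h, rfl⟩, projOrbit_orbitOf γ⟩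
    · refine ⟨⟨_, T, h.neg, rfl⟩, ?_⟩
      rw [projOrbit_orbitOf]
      simp only [projRP3_neg]

theorem projOfPair_orbitOf (γ : ℝ → S3) :
    projOfPair {orbitOf γ, antipodalOrbit (orbitOf γ)} = orbitOf fun t => projRP3 (γ t) := by
  have h1 := projOrbit_orbitOf γ
  have h2 := projOrbit_orbitOf fun t => -γ t
  simp only [projRP3_neg] at h2
  rw [projOfPair, sUnion_pair, antipodalOrbit_orbitOf, projOrbit, image_union]
  exact (congrArg₂ (· ∪ ·) h1 h2).trans (union_self _)

theorem exists_of_mem_antipodalPairs {P : Set (Set (ℝ → S3))}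
    (hP : P ∈ antipodalPairs (liftVF Z)) :
    ∃ γ T, IsPrimePeriodic (liftVF Z) γ T ∧ Disjoint (range γ) (range fun t => -γ t) ∧
      P = {orbitOf γ, antipodalOrbit (orbitOf γ)} := by
  obtain ⟨_, ⟨γ, T, hγ, rfl⟩, -, hd, rfl⟩ := hP
  rw [antipodalOrbit_orbitOf, orbitSupport_orbitOf, orbitSupport_orbitOf] at hd
  exact ⟨γ, T, hγ, hd, rfl⟩

theorem mapsTo_liftsOfOrbit :
    MapsTo (liftsOfOrbit Z) (contractiblePrimeOrbits Z) (antipodalPairs (liftVF Z)) := by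
  rintro _ ⟨ζ, T, hζ, hc, rfl⟩
  obtain ⟨γ, hγ, hp, hd⟩ := hζ.exists_lift hc
  rw [← show (fun t => projRP3 (γ t)) = ζ from funext hp]
  refine ⟨orbitOf γ, ⟨γ, T, hγ, rfl⟩, ⟨_, T, hγ.neg, antipodalOrbit_orbitOf γ⟩, ?_,
    hγ.liftsOfOrbit_eq⟩
  rwa [antipodalOrbit_orbitOf, orbitSupport_orbitOf, orbitSupport_orbitOf]

theorem mapsTo_projOfPair (hZ : IsSmoothVectorField Z) :
    MapsTo projOfPair (antipodalPairs (liftVF Z)) (contractiblePrimeOrbits Z) := by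
  intro P hP
  obtain ⟨γ, T, hγ, hd, rfl⟩ := exists_of_mem_antipodalPairs hP
  exact ⟨_, T, hγ.proj hd, isContractibleLoop_proj hZ hγ, projOfPair_orbitOf γ⟩

theorem invOn_projOfPair_liftsOfOrbit :
    InvOn projOfPair (liftsOfOrbit Z) (contractiblePrimeOrbits Z) (antipodalPairs (liftVF Z)) := by
  constructor
  · rintro _ ⟨ζ, T, hζ, hc, rfl⟩
    obtain ⟨γ, hγ, hp, -⟩ := hζ.exists_lift hc
    rw [← show (fun t => projRP3 (γ t)) = ζ from funext hp, hγ.liftsOfOrbit_eq,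
      projOfPair_orbitOf]
  · intro P hP
    obtain ⟨γ, T, hγ, hd, rfl⟩ := exists_of_mem_antipodalPairs hP
    rw [projOfPair_orbitOf, hγ.liftsOfOrbit_eq]

/-- The linking number of a periodic orbit with its antipode is an even integer. -/
theorem IsPrimePeriodic.exists_even_linkingNumber (hZ : IsSmoothVectorField Z) {γ : ℝ → S3}
    {T : ℝ} (h : IsPrimePeriodic (liftVF Z) γ T)
    (hd : Disjoint (range γ) (range fun t => -γ t)) :
    ∃ l : ℤ, HasLinkingNumber γ T (fun t => -γ t) T l ∧ Even l := by
  have hx := h.isMIntegralCurve.contDiff_coe (isSmoothVectorField_liftVF hZ)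
  have hn : ∀ t, ‖(γ t : E4)‖ = 1 := fun t => norm_eq_of_mem_sphere _
  have hp : Function.Periodic (fun t => (γ t : E4)) T := fun t => congrArg Subtype.val (h.periodic t)
  have hne : ∀ s t, (γ s : E4) ≠ -(γ t : E4) := fun s t hst =>
    Set.disjoint_left.1 hd ⟨s, rfl⟩ ⟨t, (Subtype.ext hst : γ s = -γ t).symm⟩
  have hJ : JoinIndep (fun t => (γ t : E4)) (fun t => (γ t : E4)) := by
    have := joinIndep_antipodal hn hne (p := 0) (by simp)
      (fun t h0 => by have := hn t; rw [h0, norm_zero] at this; exact zero_ne_one this)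
      (fun t h0 => by have := hn t; rw [h0, neg_zero, norm_zero] at this; exact zero_ne_one this)
    simpa using this
  obtain ⟨n, hn2⟩ := hJ.exists_joinIntegral_self_eq hx h.period_pos hp
  -- The self-join integral does not involve the pole, so all poles give the same even value.
  refine ⟨2 * n, ⟨exists_notMem_range_union_range_neg hx, fun v hv => ?_⟩, even_two_mul n⟩
  have hv1 : ∀ t, (γ t : E4) ≠ v := fun t ht => hv (Or.inl ⟨t, Subtype.ext ht⟩)
  have hv2 : ∀ t, (γ t : E4) ≠ -v := fun t ht =>
    hv (Or.inr ⟨t, Subtype.ext (neg_eq_iff_eq_neg.2 ht)⟩)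
  have key := gauss_integral_antipodal_eq (norm_eq_of_mem_sphere v) hx hn h.period_pos hp hne
    hv1 hv2
  push_cast
  rw [← hn2, ← key]
  rfl

end

theorem lemma4p1 (Z : (x : RP3) → TangentSpace (𝓡 3) x) (hZ : IsSmoothVectorField Z) :
    BijOn (liftsOfOrbit Z) (contractiblePrimeOrbits Z) (antipodalPairs (liftVF Z)) ∧
    InvOn projOfPair (liftsOfOrbit Z) (contractiblePrimeOrbits Z) (antipodalPairs (liftVF Z)) ∧
    ∀ (γ : ℝ → S3) (T : ℝ), IsPrimePeriodic (liftVF Z) γ T →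
      Disjoint (range γ) (range fun t => -γ t) →
      ∃ ℓ : ℤ, HasLinkingNumber γ T (fun t => -γ t) T ℓ ∧ Even ℓ :=
  ⟨invOn_projOfPair_liftsOfOrbit.bijOn mapsTo_liftsOfOrbit (mapsTo_projOfPair hZ),
    invOn_projOfPair_liftsOfOrbit, fun _ _ h hd => h.exists_even_linkingNumber hZ hd⟩
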